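/- Fix a countably infinite set $\mathbb{A}$ of names, and let $\mathrm{Perm}\,\mathbb{A}$ be the group of finite permutations of $\mathbb{A}$ (bijections fixing all but finitely many names). For $S\subseteq\mathbb{A}$ let $\mathrm{Perm}_S\,\mathbb{A}$ be the subgroup of those $\pi$ that fix every name in $S$. Given an action of $\mathrm{Perm}\,\mathbb{A}$ on a set $X$, a set $S$ *supports* $x\in X$ if $\pi\cdot x=x$ for all $\pi\in\mathrm{Perm}_S\,\mathbb{A}$, and the *$S$-orbit* of $x$ is $\{\pi\cdot x\mid \pi\in\mathrm{Perm}_S\,\mathbb{A}\}$; orbits are $\emptyset$-orbits. A *nominal set* is a $\mathrm{Perm}\,\mathbb{A}$-set in which every element $x$ has a finite support, hence a least one, $\operatorname{supp} x$. It is *orbit-finite* if it has finitely many orbits, and *$k$-bounded* if $|\operatorname{supp} x|\le k$ for all $x$. Subsets of a nominal set, and sets of such subsets, carry the elementwise action, to which "supported", "finitely supported" and "equivariant" (supported by $\emptyset$) refer; a finitely supported subset of a $\mathrm{Perm}\,\mathbb{A}$-set is orbit-finite if it meets only finitely many orbits. Nominal sets and equivariant maps ($f(\pi\cdot x)=\pi\cdot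 f(x)$) form a category; let $\mathbf{Nom}_{\mathrm{of},k}$ be its full subcategory of $k$-bounded orbit-finite nominal sets. A *nominal topological space* is a nominal set $X$ with an equivariant set $\mathcal{O}$ of finitely supported subsets of $X$ (the open sets) that is closed under unions of finitely supported families and under finite intersections (including $X$ itself). Morphisms are the continuous equivariant maps; this gives a category $\mathbf{nTop}$. In a *discrete* space all finitely supported subsets are open. A *basis* is an equivariant set $\mathcal{B}\subseteq\mathcal{O}$ such that every open set is a union of a finitely supported set of finite intersections of members of $\mathcal{B}$, and every finite intersection of members of $\mathcal{B}$ is a union of a finitely supported subset of $\mathcal{B}$. The space $X$ is - *compact* if every finitely supported set $\mathcal{C}\subseteq\mathcal{O}$ with $\bigcup\mathcal{C}=X$ has an orbit-finite (in particular finitely supported) subset $\mathcal{D}\subseteq\mathcal{C}$ with $\bigcup\mathcal{D}=X$; - *(nominal) Hausdorff* if, for every finite $S\subseteq\mathbb{A}$, any two points in different $S$-orbits have disjoint $S$-supported open neighbourhoods; - a *nominal Stone space* if it is compact and Hausdorff and has a basis of representable sets, where $R\subseteq X$ is *representable* if $R=f^{-1}[A]$ for some continuous equivariant map $f\colon X\to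 Y$ into an orbit-finite discrete space $Y$ and some finitely supported $A\subseteq Y$. For $k\in\mathbb{N}$ let $\mathbf{nStone}_k$ be the full subcategory of $\mathbf{nTop}$ on the $k$-bounded nominal Stone spaces. Orbit-finite discrete spaces are nominal Stone spaces, which yields a functor $E\colon\mathbf{Nom}_{\mathrm{of},k}\to\mathbf{nStone}_k$ equipping a nominal set with the discrete topology. A *codirected limit* is a limit of a small diagram indexed by a nonempty preorder in which any two elements have a lower bound. **Theorem.** For every $k\in\mathbb{N}$: 1. $E$ exhibits $\mathbf{nStone}_k$ as the Pro-completion of $\mathbf{Nom}_{\mathrm{of},k}$. That is, $\mathbf{nStone}_k$ has codirected limits; $E$ is a full embedding (full, faithful and injective on objects); and for every category $\mathbf{D}$ with codirected limits, every functor $F\colon\mathbf{Nom}_{\mathrm{of},k}\to\mathbf{D}$ extends to a functor $\bar F\colon\mathbf{nStone}_k\to\mathbf{D}$ that preserves codirected limits and satisfies $\bar F\circ E=F$, and $\bar F$ is essentially unique: for every functor $G\colon\mathbf{nStone}_k\to\mathbf{D}$ that preserves codirected limits and satisfies $G\circ E=F$ there is a natural isomorphism $\alpha\colon\bar F\cong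 G$ with $\alpha E=\mathrm{id}_F$. 2. A nominal topological space is a $k$-bounded nominal Stone space if and only if it is a codirected limit, in $\mathbf{nTop}$, of $k$-bounded orbit-finite discrete spaces. -/

import Mathlib

open CategoryTheory CategoryTheory.Limits

open scoped Pointwise

universe u v' u'

namespace NominalStone

/-! ### Finite permutations, supports, orbits -/

/-- The group `Perm 𝔸` of finite permutations of the set `𝔸` of names: the bijections that fix
all but finitely many names. -/
def finPerm (𝔸 : Type) : Subgroup (Equiv.Perm 𝔸) where
  carrier := {π | {a | π a ≠ a}.Finite}
  one_mem' := by simp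
  mul_mem' := by
    intro π σ hπ hσ
    refine (hπ.union hσ).subset ?_
    intro a ha
    by_contra h
    simp only [Set.mem_union, Set.mem_ofPred_eq, not_or, not_not] at h
    exact ha (by rw [Equiv.Perm.mul_apply, h.2, h.1])
  inv_mem' := by
    intro π hπ
    refine Set.Finite.subset hπ ?_
    intro a ha h
    exact ha (by rw [Equiv.Perm.inv_eq_iff_eq]; exact h.symm)

/-- `Perm 𝔸` as a group in its own right. It acts on `𝔸` by `π • a = π a`, and on the subsets of
any `Perm 𝔸`-set (and on sets of subsets) elementwise: `π • U = {π • x | x ∈ U}`. -/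
abbrev FinPerm (𝔸 : Type) : Type := finPerm 𝔸

/-- The subgroup `Perm_S 𝔸` of the finite permutations that fix every name in `S`. -/
abbrev permFixing (𝔸 : Type) (S : Finset 𝔸) : Subgroup (FinPerm 𝔸) :=
  fixingSubgroup (FinPerm 𝔸) (S : Set 𝔸)

/-- `S` supports `x`: every `π ∈ Perm_S 𝔸` fixes `x`. -/
abbrev SupportedBy (𝔸 : Type) {X : Type*} [SMul (FinPerm 𝔸) X] (S : Finset 𝔸) (x : X) : Prop :=
  MulAction.Supports (FinPerm 𝔸) (S : Set 𝔸) x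

/-- `x` has a finite support. -/
def FinitelySupported (𝔸 : Type) {X : Type*} [SMul (FinPerm 𝔸) X] (x : X) : Prop :=
  ∃ S : Finset 𝔸, SupportedBy 𝔸 S x

/-- The least finite support of a finitely supported element `x`, as the intersection of all
finite supports of `x` (when `𝔸` is infinite, this intersection is itself a support). -/
def supp (𝔸 : Type) {X : Type*} [SMul (FinPerm 𝔸) X] (x : X) : Set 𝔸 :=
  {a | ∀ S : Finset 𝔸, SupportedBy 𝔸 S x → a ∈ S}

/-- The `S`-orbit `{π • x | π ∈ Perm_S 𝔸}` of `x`. -/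
abbrev orb (𝔸 : Type) {X : Type*} [MulAction (FinPerm 𝔸) X] (S : Finset 𝔸) (x : X) : Set X :=
  MulAction.orbit (permFixing 𝔸 S) x

/-- A finitely supported subset is orbit-finite if it meets only finitely many orbits. -/
def OrbitFiniteSubset (𝔸 : Type) {X : Type*} [MulAction (FinPerm 𝔸) X] (Y : Set X) : Prop :=
  FinitelySupported 𝔸 Y ∧ ((fun y => MulAction.orbit (FinPerm 𝔸) y) '' Y).Finite

section Lemmas

variable {𝔸 : Type} {X Y : Type*} [MulAction (FinPerm 𝔸) X] [MulAction (FinPerm 𝔸) Y]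

theorem FinitelySupported.smul {x : X} (h : FinitelySupported 𝔸 x) (π : FinPerm 𝔸) :
    FinitelySupported 𝔸 (π • x) := by
  classical
  obtain ⟨S, hS⟩ := h
  refine ⟨S.image (fun a => π • a), fun σ hσ => ?_⟩
  have h1 : (π⁻¹ * σ * π) • x = x := by
    refine hS _ fun a ha => ?_
    have h2 : σ • π • a = π • a :=
      hσ (by rw [Finset.coe_image]; exact Set.mem_image_of_mem (fun a => π • a) ha)
    rw [mul_smul, mul_smul, h2, inv_smul_smul]
  rw [mul_smul, mul_smul, inv_smul_eq_iff] at h1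
  exact h1

theorem finitelySupported_univ : FinitelySupported 𝔸 (Set.univ : Set X) :=
  ⟨∅, fun _ _ => Set.smul_set_univ⟩

theorem FinitelySupported.inter {U V : Set X} (hU : FinitelySupported 𝔸 U)
    (hV : FinitelySupported 𝔸 V) : FinitelySupported 𝔸 (U ∩ V) := by
  classical
  obtain ⟨S, hS⟩ := hU
  obtain ⟨T, hT⟩ := hV
  refine ⟨S ∪ T, fun π hπ => ?_⟩
  rw [Set.smul_set_inter, hS π fun a ha => hπ (by simp at ha; simp [ha]),
    hT π fun a ha => hπ (by simp at ha; simp [ha])]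

theorem smul_sUnion (π : FinPerm 𝔸) (𝒰 : Set (Set X)) : π • ⋃₀ 𝒰 = ⋃₀ (π • 𝒰) := by
  ext x
  simp only [Set.mem_smul_set_iff_inv_smul_mem, Set.mem_sUnion]
  constructor
  · rintro ⟨U, hU, hx⟩
    exact ⟨π • U, by simpa using hU, Set.mem_smul_set_iff_inv_smul_mem.2 hx⟩
  · rintro ⟨U, hU, hx⟩
    exact ⟨π⁻¹ • U, hU, Set.smul_mem_smul_set hx⟩

theorem FinitelySupported.sUnion {𝒰 : Set (Set X)} (h : FinitelySupported 𝔸 𝒰) :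
    FinitelySupported 𝔸 (⋃₀ 𝒰) := by
  obtain ⟨S, hS⟩ := h
  exact ⟨S, fun π hπ => by rw [smul_sUnion, hS π hπ]⟩

theorem smul_preimage (f : X →[FinPerm 𝔸] Y) (π : FinPerm 𝔸) (U : Set Y) :
    π • (f ⁻¹' U) = f ⁻¹' (π • U) := by
  ext x
  simp [Set.mem_smul_set_iff_inv_smul_mem, map_smul]

theorem FinitelySupported.preimage (f : X →[FinPerm 𝔸] Y) {U : Set Y}
    (h : FinitelySupported 𝔸 U) : FinitelySupported 𝔸 (f ⁻¹' U) := by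
  obtain ⟨S, hS⟩ := h
  exact ⟨S, fun π hπ => by rw [smul_preimage, hS π hπ]⟩

theorem FinitelySupported.singleton {x : X} (h : FinitelySupported 𝔸 x) :
    FinitelySupported 𝔸 ({x} : Set X) := by
  obtain ⟨S, hS⟩ := h
  exact ⟨S, fun π hπ => by rw [Set.smul_set_singleton, hS π hπ]⟩

theorem supportedBy_orb (S : Finset 𝔸) (x : X) : SupportedBy 𝔸 S (orb 𝔸 S x) := by
  intro π hπ
  have hm : π ∈ permFixing 𝔸 S := (mem_fixingSubgroup_iff _).2 fun a ha => hπ ha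
  exact MulAction.smul_orbit (⟨π, hm⟩ : permFixing 𝔸 S) x

end Lemmas

/-! ### Nominal sets -/

/-- A nominal set: a set with an action of `Perm 𝔸` such that each element has a finite
support. -/
structure NomSet (𝔸 : Type) : Type (u + 1) where
  /-- The underlying set. -/
  carrier : Type u
  [action : MulAction (FinPerm 𝔸) carrier]
  finitelySupported : ∀ x : carrier, FinitelySupported 𝔸 x

attribute [instance] NomSet.action

instance (𝔸 : Type) : CoeSort (NomSet.{u} 𝔸) (Type u) := ⟨NomSet.carrier⟩

/-- The category `Nom` of nominal sets and equivariant maps. -/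
instance (𝔸 : Type) : Category.{u} (NomSet.{u} 𝔸) where
  Hom X Y := X →[FinPerm 𝔸] Y
  id X := MulActionHom.id (FinPerm 𝔸)
  comp f g := g.comp f

/-- A nominal set is orbit-finite if it has only finitely many orbits. -/
def NomSet.OrbitFinite {𝔸 : Type} (X : NomSet.{u} 𝔸) : Prop :=
  Finite (MulAction.orbitRel.Quotient (FinPerm 𝔸) X)

/-- A nominal set is `k`-bounded if `|supp x| ≤ k` for all its elements `x`. -/
def NomSet.Bounded {𝔸 : Type} (k : ℕ) (X : NomSet.{u} 𝔸) : Prop :=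
  ∀ x : X, (supp 𝔸 x).encard ≤ k

/-- The property of being a `k`-bounded orbit-finite nominal set. -/
def isBoundedOrbitFinite (𝔸 : Type) (k : ℕ) : ObjectProperty (NomSet.{u} 𝔸) :=
  fun X => X.Bounded k ∧ X.OrbitFinite

/-- The category of `k`-bounded orbit-finite nominal sets, a full subcategory of `Nom`. -/
abbrev NomOF (𝔸 : Type) (k : ℕ) : Type (u + 1) :=
  (isBoundedOrbitFinite.{u} 𝔸 k).FullSubcategory

/-! ### Nominal topological spaces -/

/-- A nominal topology on a `Perm 𝔸`-set: an equivariant set of finitely supported subsets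
that is closed under finitely supported unions and finite intersections. -/
structure NomTopology (𝔸 : Type) (X : Type u) [MulAction (FinPerm 𝔸) X] : Type u where
  /-- The open sets. -/
  opens : Set (Set X)
  finitelySupported : ∀ U ∈ opens, FinitelySupported 𝔸 U
  smul_mem : ∀ (π : FinPerm 𝔸), ∀ U ∈ opens, π • U ∈ opens
  sUnion_mem : ∀ 𝒰 : Set (Set X), 𝒰 ⊆ opens → FinitelySupported 𝔸 𝒰 → ⋃₀ 𝒰 ∈ opens
  univ_mem : Set.univ ∈ opens
  inter_mem : ∀ U ∈ opens, ∀ V ∈ opens, U ∩ V ∈ opens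

/-- A nominal topological space. -/
structure NomTop (𝔸 : Type) : Type (u + 1) where
  /-- The underlying nominal set. -/
  toNom : NomSet.{u} 𝔸
  /-- The nominal topology. -/
  top : NomTopology 𝔸 toNom

instance (𝔸 : Type) : CoeSort (NomTop.{u} 𝔸) (Type u) := ⟨fun X => X.toNom.carrier⟩

/-- Continuous equivariant maps. -/
@[ext]
structure NomTop.Hom {𝔸 : Type} (X Y : NomTop.{u} 𝔸) : Type u where
  /-- The underlying equivariant map. -/
  toMap : X →[FinPerm 𝔸] Y
  continuous : ∀ U ∈ Y.top.opens, toMap ⁻¹' U ∈ X.top.opens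

/-- The category of nominal topological spaces and continuous equivariant maps. -/
instance (𝔸 : Type) : Category.{u} (NomTop.{u} 𝔸) where
  Hom X Y := NomTop.Hom X Y
  id X := ⟨MulActionHom.id (FinPerm 𝔸), fun _ hU => hU⟩
  comp f g := ⟨g.toMap.comp f.toMap, fun U hU => f.continuous _ (g.continuous U hU)⟩

/-- The discrete topology: all finitely supported subsets are open. -/
def discreteTopology (𝔸 : Type) (X : Type u) [MulAction (FinPerm 𝔸) X] : NomTopology 𝔸 X where
  opens := {U | FinitelySupported 𝔸 U}
  finitelySupported _ hU := hU
  smul_mem π _ hU := FinitelySupported.smul hU π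
  sUnion_mem _ _ h := h.sUnion
  univ_mem := finitelySupported_univ
  inter_mem _ hU _ hV := FinitelySupported.inter hU hV

/-- The functor equipping a nominal set with its discrete topology. -/
def discrete (𝔸 : Type) : NomSet.{u} 𝔸 ⥤ NomTop.{u} 𝔸 where
  obj X := ⟨X, discreteTopology 𝔸 X⟩
  map f := ⟨f, fun _ hU => FinitelySupported.preimage f hU⟩

namespace NomTop

variable {𝔸 : Type}

/-- A subbasis: an equivariant set `ℬ` of open sets such that each open set is a finitely
supported union of finite intersections of members of `ℬ`. -/
def IsSubbasis (X : NomTop.{u} 𝔸) (ℬ : Set (Set X)) : Prop :=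
  ℬ ⊆ X.top.opens ∧ (∀ π : FinPerm 𝔸, ∀ B ∈ ℬ, π • B ∈ ℬ) ∧
    ∀ U ∈ X.top.opens, ∃ 𝒰 : Set (Set X), FinitelySupported 𝔸 𝒰 ∧
      (∀ V ∈ 𝒰, ∃ ℱ : Set (Set X), ℱ ⊆ ℬ ∧ ℱ.Finite ∧ V = ⋂₀ ℱ) ∧ U = ⋃₀ 𝒰

/-- A basis: a subbasis `ℬ` such that each finite intersection of members of `ℬ` is a finitely
supported union of members of `ℬ`. -/
def IsBasis (X : NomTop.{u} 𝔸) (ℬ : Set (Set X)) : Prop :=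
  X.IsSubbasis ℬ ∧ ∀ ℱ : Set (Set X), ℱ ⊆ ℬ → ℱ.Finite →
    ∃ 𝒰 : Set (Set X), FinitelySupported 𝔸 𝒰 ∧ 𝒰 ⊆ ℬ ∧ ⋂₀ ℱ = ⋃₀ 𝒰

/-- Nominal compactness: each finitely supported open cover has an orbit-finite (in particular,
finitely supported) subcover. -/
def Compact (X : NomTop.{u} 𝔸) : Prop :=
  ∀ 𝒞 : Set (Set X), 𝒞 ⊆ X.top.opens → FinitelySupported 𝔸 𝒞 → ⋃₀ 𝒞 = Set.univ →
    ∃ 𝒟 : Set (Set X), 𝒟 ⊆ 𝒞 ∧ OrbitFiniteSubset 𝔸 𝒟 ∧ ⋃₀ 𝒟 = Set.univ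

/-- The nominal Hausdorff property: for each finite set `S` of names, points in different
`S`-orbits have disjoint `S`-supported open neighbourhoods. -/
def Hausdorff (X : NomTop.{u} 𝔸) : Prop :=
  ∀ (S : Finset 𝔸) (x₁ x₂ : X), orb 𝔸 S x₁ ≠ orb 𝔸 S x₂ →
    ∃ U₁ ∈ X.top.opens, ∃ U₂ ∈ X.top.opens,
      SupportedBy 𝔸 S U₁ ∧ SupportedBy 𝔸 S U₂ ∧ x₁ ∈ U₁ ∧ x₂ ∈ U₂ ∧ Disjoint U₁ U₂

/-- A subset is representable if it is the preimage of a finitely supported subset under a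
continuous equivariant map into an orbit-finite discrete space. -/
def Representable (X : NomTop.{u} 𝔸) (R : Set X) : Prop :=
  ∃ (Y : NomSet.{u} 𝔸) (f : X ⟶ (discrete 𝔸).obj Y) (A : Set Y),
    Y.OrbitFinite ∧ FinitelySupported 𝔸 A ∧ R = f.toMap ⁻¹' A

/-- A nominal Stone space: nominal compact Hausdorff with a basis of representable sets. -/
def IsStone (X : NomTop.{u} 𝔸) : Prop :=
  X.Compact ∧ X.Hausdorff ∧
    ∃ ℬ : Set (Set X), (∀ B ∈ ℬ, X.Representable B) ∧ X.IsBasis ℬ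

end NomTop

/-- The property of being a `k`-bounded nominal Stone space. -/
def isBoundedStone (𝔸 : Type) (k : ℕ) : ObjectProperty (NomTop.{u} 𝔸) :=
  fun X => X.toNom.Bounded k ∧ X.IsStone

/-- The category of `k`-bounded nominal Stone spaces, a full subcategory of the category of
nominal topological spaces. -/
abbrev NStone (𝔸 : Type) (k : ℕ) : Type (u + 1) :=
  (isBoundedStone.{u} 𝔸 k).FullSubcategory

/-- Two finite permutations that agree on a finite set `T` up to names outside `S` differ on `T`
by a finite permutation fixing `S`. -/
theorem exists_permFixing {𝔸 : Type} (S T : Finset 𝔸) (π σ : FinPerm 𝔸)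
    (h : ∀ a ∈ T, π • a ∈ S ∨ σ • a ∈ S → π • a = σ • a) :
    ∃ τ ∈ permFixing 𝔸 S, ∀ a ∈ T, τ • π • a = σ • a := by
  classical
  let Z : Finset 𝔸 := S ∪ (T.image (fun a => π • a) ∪ T.image (fun a => σ • a))
  let f : Z → 𝔸 := fun w => if (w : 𝔸) ∈ S then w else σ • π⁻¹ • (w : 𝔸)
  let s : Finset Z := Finset.univ.filter fun w => (w : 𝔸) ∈ S ∨ (w : 𝔸) ∈ T.image (fun a => π • a)
  have hfS : ∀ w : Z, (w : 𝔸) ∈ S → f w = w := fun w hw => if_pos hw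
  have hfN : ∀ w : Z, (w : 𝔸) ∉ S → f w = σ • π⁻¹ • (w : 𝔸) := fun w hw => if_neg hw
  have hfst : s.image f ⊆ Z := by
    intro b hb
    obtain ⟨w, hw, rfl⟩ := Finset.mem_image.1 hb
    by_cases hS : (w : 𝔸) ∈ S
    · rw [hfS w hS]; exact w.2
    · have hw' := (Finset.mem_filter.1 hw).2.resolve_left hS
      obtain ⟨a, ha, hpa⟩ := Finset.mem_image.1 hw'
      rw [hfN w hS, ← hpa, inv_smul_smul]
      exact Finset.mem_union_right _ (Finset.mem_union_right _ (Finset.mem_image_of_mem _ ha))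
  have key : ∀ w w' : Z, w ∈ s → w' ∈ s → (w : 𝔸) ∈ S → (w' : 𝔸) ∉ S → f w ≠ f w' := by
    intro w w' _ hw' hS hS' he
    obtain ⟨a, ha, hpa⟩ := Finset.mem_image.1 ((Finset.mem_filter.1 hw').2.resolve_left hS')
    rw [hfS w hS, hfN w' hS', ← hpa, inv_smul_smul] at he
    have hσ : σ • a ∈ S := by rw [← he]; exact hS
    have h1 : π • a = σ • a := h a ha (Or.inr hσ)
    exact hS' (by rw [← hpa, h1]; exact hσ)
  have hinj : Set.InjOn f s := by
    intro w hw w' hw' he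
    by_cases hS : (w : 𝔸) ∈ S <;> by_cases hS' : (w' : 𝔸) ∈ S
    · rw [hfS w hS, hfS w' hS'] at he; exact Subtype.ext he
    · exact absurd he (key w w' hw hw' hS hS')
    · exact absurd he.symm (key w' w hw' hw hS' hS)
    · rw [hfN w hS, hfN w' hS', smul_left_cancel_iff, smul_left_cancel_iff] at he
      exact Subtype.ext he
  obtain ⟨g, hg⟩ := Finset.exists_equiv_extend_of_card_eq (t := Z) (by simp) hfst hinj
  let τ : Equiv.Perm 𝔸 := Equiv.Perm.ofSubtype (p := fun a => a ∈ Z) g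
  have hτ : ∀ w (hw : w ∈ Z), τ w = g ⟨w, hw⟩ := fun w hw =>
    Equiv.Perm.ofSubtype_apply_of_mem g hw
  have hfin : τ ∈ finPerm 𝔸 := by
    refine Z.finite_toSet.subset fun a ha => ?_
    by_contra hn
    exact ha (Equiv.Perm.ofSubtype_apply_of_not_mem g hn)
  refine ⟨⟨τ, hfin⟩, (mem_fixingSubgroup_iff _).2 fun a ha => ?_, fun a ha => ?_⟩
  · have haS : a ∈ S := ha
    have haZ : a ∈ Z := Finset.mem_union_left _ haS
    have h1 := hg ⟨a, haZ⟩ (Finset.mem_filter.2 ⟨Finset.mem_univ _, Or.inl haS⟩)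
    rw [hfS _ haS] at h1
    exact (hτ a haZ).trans h1
  · have haT : π • a ∈ T.image (fun a => π • a) := Finset.mem_image_of_mem _ ha
    have haZ : π • a ∈ Z := Finset.mem_union_right _ (Finset.mem_union_left _ haT)
    have h1 := hg ⟨π • a, haZ⟩ (Finset.mem_filter.2 ⟨Finset.mem_univ _, Or.inr haT⟩)
    refine ((hτ _ haZ).trans h1).trans ?_
    by_cases hS : π • a ∈ S
    · rw [hfS _ hS]; exact h a ha (Or.inl hS)
    · rw [hfN _ hS, inv_smul_smul]

/-- An orbit-finite nominal set has only finitely many `S`-orbits. -/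
theorem NomSet.OrbitFinite.exists_finite {𝔸 : Type} {X : NomSet.{u} 𝔸} (hX : X.OrbitFinite)
    (S : Finset 𝔸) : ∃ F : Set X, F.Finite ∧ ∀ x : X, ∃ τ ∈ permFixing 𝔸 S, τ • x ∈ F := by
  classical
  have hone : ∀ r : X, ∃ F : Set X, F.Finite ∧
      ∀ π : FinPerm 𝔸, ∃ τ ∈ permFixing 𝔸 S, τ • π • r ∈ F := by
    intro r
    obtain ⟨T, hT⟩ := X.finitelySupported r
    let pat : FinPerm 𝔸 → (T → Option S) := fun π a =>
      if h : π • (a : 𝔸) ∈ S then some ⟨_, h⟩ else none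
    refine ⟨Set.range fun p : Set.range pat => p.2.choose • r, Set.finite_range _, fun π => ?_⟩
    let p : Set.range pat := ⟨pat π, π, rfl⟩
    have hp : pat p.2.choose = pat π := p.2.choose_spec
    obtain ⟨τ, hτ, hτT⟩ := exists_permFixing S T π p.2.choose (by
      intro a ha h
      have := congrFun hp ⟨a, ha⟩
      simp only [pat] at this
      split_ifs at this with h1 h2 h3
      · simpa using (congrArg Subtype.val (Option.some.inj this)).symm
      · exact absurd h (by tauto))
    refine ⟨τ, hτ, p, ?_⟩
    have h2 : (p.2.choose⁻¹ * τ * π) • r = r := hT _ fun a ha => by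
      rw [mul_smul, mul_smul, hτT a ha, inv_smul_smul]
    rw [mul_smul, mul_smul, inv_smul_eq_iff] at h2
    exact h2.symm
  choose F hF hF' using hone
  have : Finite (MulAction.orbitRel.Quotient (FinPerm 𝔸) X) := hX
  refine ⟨⋃ q : MulAction.orbitRel.Quotient (FinPerm 𝔸) X, F (Quotient.out q),
    Set.finite_iUnion fun _ => hF _, fun x => ?_⟩
  let q : MulAction.orbitRel.Quotient (FinPerm 𝔸) X := Quotient.mk'' x
  have hq : x ∈ MulAction.orbit (FinPerm 𝔸) (Quotient.out q) :=
    MulAction.orbitRel_apply.1 (Quotient.exact (Quotient.out_eq q).symm)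
  obtain ⟨π, hπ⟩ := hq
  obtain ⟨τ, hτ, h⟩ := hF' (Quotient.out q) π
  refine ⟨τ, hτ, Set.mem_iUnion.2 ⟨q, ?_⟩⟩
  rw [← hπ]
  exact h

/-- Orbit-finite discrete spaces are nominal Stone spaces. -/
theorem isStone_discrete {𝔸 : Type} (X : NomSet.{u} 𝔸) (hX : X.OrbitFinite) :
    ((discrete 𝔸).obj X).IsStone := by
  classical
  refine ⟨?_, ?_, {U | FinitelySupported 𝔸 U}, ?_, ⟨fun _ h => h, fun π B hB =>
    FinitelySupported.smul hB π, ?_⟩, ?_⟩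
  · intro 𝒞 _ hfs hcov
    obtain ⟨S, hS⟩ := hfs
    obtain ⟨F, hF, hFS⟩ := hX.exists_finite S
    have hex : ∀ x : X, ∃ U ∈ 𝒞, x ∈ U := fun x => by
      have : x ∈ ⋃₀ 𝒞 := by rw [hcov]; trivial
      exact this
    choose U hU hxU using hex
    have hsm : ∀ τ ∈ permFixing 𝔸 S, ∀ V ∈ 𝒞, τ • V ∈ 𝒞 := fun τ hτ V hV => by
      have h1 : τ • 𝒞 = 𝒞 := hS τ fun a ha => (mem_fixingSubgroup_iff _).1 hτ a ha
      rw [← h1]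
      exact Set.smul_mem_smul_set hV
    refine ⟨{V | ∃ x ∈ F, ∃ τ ∈ permFixing 𝔸 S, V = τ • U x}, ?_, ⟨⟨S, fun π hπ => ?_⟩, ?_⟩, ?_⟩
    · rintro V ⟨x, _, τ, hτ, rfl⟩
      exact hsm τ hτ _ (hU x)
    · have hm : π ∈ permFixing 𝔸 S := (mem_fixingSubgroup_iff _).2 fun a ha => hπ ha
      ext V
      rw [Set.mem_smul_set_iff_inv_smul_mem]
      constructor
      · rintro ⟨x, hx, τ, hτ, h⟩
        exact ⟨x, hx, π * τ, mul_mem hm hτ, by rw [mul_smul, ← h, smul_inv_smul]⟩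
      · rintro ⟨x, hx, τ, hτ, h⟩
        exact ⟨x, hx, π⁻¹ * τ, mul_mem (inv_mem hm) hτ, by rw [mul_smul, ← h]⟩
    · refine (hF.image fun x => MulAction.orbit (FinPerm 𝔸) (U x)).subset ?_
      rintro _ ⟨_, ⟨x, hx, τ, _, rfl⟩, rfl⟩
      exact ⟨x, hx, (MulAction.orbit_smul _ _).symm⟩
    · refine Set.eq_univ_of_forall fun x => ?_
      obtain ⟨τ, hτ, hx⟩ := hFS x
      refine ⟨τ⁻¹ • U (τ • x), ⟨_, hx, τ⁻¹, inv_mem hτ, rfl⟩, ?_⟩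
      rw [Set.mem_smul_set_iff_inv_smul_mem, inv_inv]
      exact hxU _
  · intro S x₁ x₂ hne
    have fs : ∀ x : X, FinitelySupported 𝔸 (orb 𝔸 S x) := fun x => ⟨S, supportedBy_orb S x⟩
    refine ⟨orb 𝔸 S x₁, fs x₁, orb 𝔸 S x₂, fs x₂, supportedBy_orb S x₁, supportedBy_orb S x₂,
      MulAction.mem_orbit_self _, MulAction.mem_orbit_self _, ?_⟩
    rw [Set.disjoint_left]
    intro y h1 h2
    exact hne ((MulAction.orbit_eq_iff.2 h1).symm.trans (MulAction.orbit_eq_iff.2 h2))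
  · intro B hB
    exact ⟨X, 𝟙 _, B, hX, hB, rfl⟩
  · intro U hU
    refine ⟨{U}, FinitelySupported.singleton hU, ?_, by simp⟩
    rintro V rfl
    exact ⟨{V}, Set.singleton_subset_iff.2 hU, Set.finite_singleton _, by simp⟩
  · intro ℱ hℱ hfin
    have h : FinitelySupported 𝔸 (⋂₀ ℱ) := by
      induction ℱ, hfin using Set.Finite.induction_on with
      | empty => simpa using finitelySupported_univ
      | insert _ _ ih =>
        rw [Set.sInter_insert]
        exact FinitelySupported.inter (hℱ (Set.mem_insert _ _))
          (ih fun _ h => hℱ (Set.mem_insert_of_mem _ h))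
    exact ⟨{⋂₀ ℱ}, FinitelySupported.singleton h, Set.singleton_subset_iff.2 h, by simp⟩

/-- The full embedding of `k`-bounded orbit-finite nominal sets, viewed as discrete spaces, into
`k`-bounded nominal Stone spaces. -/
def discreteStone (𝔸 : Type) (k : ℕ) : NomOF.{u} 𝔸 k ⥤ NStone.{u} 𝔸 k :=
  (isBoundedStone.{u} 𝔸 k).lift ((isBoundedOrbitFinite.{u} 𝔸 k).ι ⋙ discrete 𝔸)
    fun X => ⟨X.property.1, isStone_discrete X.obj X.property.2⟩

/-! ### Codirected limits and Pro-completions -/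

/-- The category `D` has limits of all small codirected diagrams. -/
def HasCodirectedLimits (D : Type u') [Category.{v'} D] : Prop :=
  ∀ (I : Type u) [Preorder I] [Nonempty I] [IsCodirectedOrder I], HasLimitsOfShape I D

/-- The functor `F` preserves limits of all small codirected diagrams. -/
def PreservesCodirectedLimits {C : Type*} [Category C] {D : Type*} [Category D]
    (F : C ⥤ D) : Prop :=
  ∀ (I : Type u) [Preorder I] [Nonempty I] [IsCodirectedOrder I],
    PreservesLimitsOfShape I F

/-- `E : C ⥤ P` exhibits `P` as a Pro-completion of `C`: `P` has codirected limits, `E` is a full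
embedding, and each functor `F : C ⥤ D` into a category with codirected limits extends along `E`
to a functor `F' : P ⥤ D` preserving codirected limits, with `E ⋙ F' = F`, which is essentially
unique: any other such extension `G` is isomorphic to `F'` by a natural isomorphism that is the
identity on `C`. -/
structure IsProCompletion {C : Type*} [Category C] {P : Type*} [Category P] (E : C ⥤ P) :
    Prop where
  hasCodirectedLimits : HasCodirectedLimits.{u} P
  full : E.Full
  faithful : E.Faithful
  injective : Function.Injective E.obj
  extension : ∀ (D : Type u') [Category.{v'} D], HasCodirectedLimits.{u} D → ∀ F : C ⥤ D,
    ∃ F' : P ⥤ D, PreservesCodirectedLimits.{u} F' ∧ ∃ hF' : E ⋙ F' = F,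
      ∀ G : P ⥤ D, PreservesCodirectedLimits.{u} G → ∀ hG : E ⋙ G = F,
        ∃ α : F' ≅ G, Functor.whiskerLeft E α.hom = eqToHom (hF'.trans hG.symm)

/-- `X` is a codirected limit, in the category of nominal topological spaces, of a diagram of
`k`-bounded orbit-finite discrete spaces. -/
def IsCodirectedLimitOfDiscrete {𝔸 : Type} (k : ℕ) (X : NomTop.{u} 𝔸) : Prop :=
  ∃ (I : Type u) (_ : Preorder I) (_ : Nonempty I) (_ : IsCodirectedOrder I)
    (D : I ⥤ NomOF.{u} 𝔸 k)
    (c : Cone (D ⋙ (isBoundedOrbitFinite.{u} 𝔸 k).ι ⋙ discrete 𝔸)),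
    c.pt = X ∧ Nonempty (IsLimit c)

end NominalStone

/-!
For a nominal topological space `X` and a finite set `S` of names, the `S`-supported open sets form
an ordinary topology on the set of `S`-orbits of `X`. In terms of these spaces `OrbitSpace X S`,
nominal compactness and the nominal Hausdorff property say that all of them are compact and
Hausdorff (`OrbitSpace.compact_iff`, `OrbitSpace.hausdorff_iff`), which makes the classical
compactness arguments available.

In a codirected diagram of `k`-bounded spaces the supports of the components of a compatible family
stabilize, so that limits are formed on the level of points (`exists_isConcreteLimit`). For the same
reason, passing to `S`-orbits commutes with these limits: only finitely many points of an orbit have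
their supports in a given finite set, so that a finiteness argument of König type lifts orbits to
points (`IsConcreteLimit.mk_eq_mk`, `IsConcreteLimit.exists_mk_eq`). So the space of `S`-orbits of
the limit is a closed subspace of a product of compact Hausdorff spaces, and limits of bounded Stone
spaces are bounded Stone spaces (`IsConcreteLimit.isStone`). Conversely, a bounded Stone space is
the limit of its quotients by open congruences (`OpenCongr.isConcreteLimit_cone`), which are
orbit-finite by compactness.

Compactness also yields that orbit-finite discrete spaces are finitely copresentable among the
bounded Stone spaces (`IsConcreteLimit.exists_factor`, `IsConcreteLimit.exists_hom_comp_eq`). The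
universal property of the Pro-completion then follows formally (`isProCompletion_of_copresentable`):
the extension of a functor is its pointwise right Kan extension, made strict on the embedded
category, and it preserves codirected limits by copresentability. Any other extension that preserves
codirected limits maps to the Kan extension by its universal property, and this map is invertible
because each object is a codirected limit of objects of the embedded category.
-/

namespace NominalStone

/-! ### Least supports -/

section Supports

variable {𝔸 : Type} {X Y : Type*} [MulAction (FinPerm 𝔸) X] [MulAction (FinPerm 𝔸) Y]

theorem mem_permFixing {S : Finset 𝔸} {π : FinPerm 𝔸} :
    π ∈ permFixing 𝔸 S ↔ ∀ a ∈ S, π • a = a :=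
  mem_fixingSubgroup_iff _

theorem SupportedBy.smul_eq {S : Finset 𝔸} {x : X} (h : SupportedBy 𝔸 S x) {π : FinPerm 𝔸}
    (hπ : π ∈ permFixing 𝔸 S) : π • x = x :=
  h π fun _ ha => mem_permFixing.1 hπ _ ha

theorem supportedBy_of_forall {S : Finset 𝔸} {x : X}
    (h : ∀ π ∈ permFixing 𝔸 S, π • x = x) : SupportedBy 𝔸 S x :=
  fun π hπ => h π (mem_permFixing.2 fun _ ha => hπ ha)

theorem SupportedBy.mono {S T : Finset 𝔸} {x : X} (h : SupportedBy 𝔸 S x) (hST : S ⊆ T) :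
    SupportedBy 𝔸 T x :=
  MulAction.Supports.mono (by exact_mod_cast hST) h

theorem SupportedBy.smul_congr {S : Finset 𝔸} {x : X} (h : SupportedBy 𝔸 S x)
    {π σ : FinPerm 𝔸} (hπσ : ∀ a ∈ S, π • a = σ • a) : π • x = σ • x := by
  rw [← inv_smul_eq_iff, ← mul_smul]
  exact h _ fun a ha => by rw [mul_smul, hπσ a ha, inv_smul_smul]

theorem SupportedBy.smul [DecidableEq 𝔸] {S : Finset 𝔸} {x : X} (h : SupportedBy 𝔸 S x)
    (π : FinPerm 𝔸) : SupportedBy 𝔸 (π • S) (π • x) := by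
  intro σ hσ
  rw [← mul_smul]
  refine h.smul_congr fun a ha => ?_
  rw [mul_smul]
  exact hσ (Finset.mem_coe.2 (Finset.smul_mem_smul_finset ha))

theorem SupportedBy.map {S : Finset 𝔸} {x : X} (h : SupportedBy 𝔸 S x)
    (f : X →[FinPerm 𝔸] Y) : SupportedBy 𝔸 S (f x) := fun π hπ => by
  rw [← map_smul, h π hπ]

theorem FinitelySupported.map {x : X} (h : FinitelySupported 𝔸 x) (f : X →[FinPerm 𝔸] Y) :
    FinitelySupported 𝔸 (f x) :=
  h.imp fun _ hS => hS.map f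

open Classical in
/-- The transposition of two names. -/
noncomputable def swapName (a b : 𝔸) : FinPerm 𝔸 :=
  ⟨Equiv.swap a b, show Set.Finite _ from (Set.toFinite {a, b}).subset fun c hc => by
    by_contra h
    simp only [Set.mem_insert_iff, Set.mem_singleton_iff, not_or] at h
    exact hc (Equiv.swap_apply_of_ne_of_ne h.1 h.2)⟩

theorem swapName_left (a b : 𝔸) : swapName a b • a = b := by
  classical
  exact Equiv.swap_apply_left a b

theorem swapName_of_ne {a b c : 𝔸} (h : c ≠ a) (h' : c ≠ b) : swapName a b • c = c := by
  classical
  exact Equiv.swap_apply_of_ne_of_ne h h'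

variable [Infinite 𝔸]

/-- A name `a` outside some support `T` can be dropped from any other support `S`: given `π`
fixing `S` except for `a`, swap `a` with a name that `π` fixes and that is fresh for `S` and `T`. -/
theorem SupportedBy.erase [DecidableEq 𝔸] {S T : Finset 𝔸} {x : X} (hS : SupportedBy 𝔸 S x)
    (hT : SupportedBy 𝔸 T x) {a : 𝔸} (ha : a ∉ T) : SupportedBy 𝔸 (S.erase a) x := by
  intro π hπ
  have hfin : {c | (π : Equiv.Perm 𝔸) c ≠ c}.Finite := π.2
  obtain ⟨b, hb⟩ := Infinite.exists_notMem_finset (S ∪ T ∪ hfin.toFinset ∪ {a})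
  simp only [Finset.mem_union, Set.Finite.mem_toFinset, Set.mem_ofPred_eq, not_or, not_not,
    Finset.mem_singleton] at hb
  obtain ⟨⟨⟨hbS, hbT⟩, hbπ⟩, hba⟩ := hb
  have h1 : swapName a b • x = x := hT _ fun c hc =>
    swapName_of_ne (fun h => ha (h ▸ hc)) (fun h => hbT (h ▸ hc))
  rw [← h1, ← mul_smul]
  refine hS.smul_congr fun c hc => ?_
  rw [mul_smul]
  by_cases hca : c = a
  · rw [hca, swapName_left]; exact hbπ
  · rw [swapName_of_ne hca (by rintro rfl; exact hbS hc)]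
    exact hπ (by simp [hca, hc])

theorem FinitelySupported.exists_least {x : X} (h : FinitelySupported 𝔸 x) :
    ∃ S : Finset 𝔸, ∀ T : Finset 𝔸, SupportedBy 𝔸 T x ↔ S ⊆ T := by
  classical
  obtain ⟨S, hS, hmin⟩ := exists_minimal_of_wellFoundedLT (fun S : Finset 𝔸 => SupportedBy 𝔸 S x) h
  refine ⟨S, fun T => ⟨fun hT a ha => ?_, fun hST => hS.mono hST⟩⟩
  by_contra haT
  exact Finset.notMem_erase a S (hmin (hS.erase hT haT) (Finset.erase_subset a S) ha)

/-- The least support of a finitely supported element as a finite set of names. -/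
noncomputable def FinitelySupported.least {x : X} (h : FinitelySupported 𝔸 x) : Finset 𝔸 :=
  h.exists_least.choose

theorem FinitelySupported.supportedBy_iff {x : X} (h : FinitelySupported 𝔸 x) {T : Finset 𝔸} :
    SupportedBy 𝔸 T x ↔ h.least ⊆ T :=
  h.exists_least.choose_spec T

theorem FinitelySupported.supportedBy_least {x : X} (h : FinitelySupported 𝔸 x) :
    SupportedBy 𝔸 h.least x :=
  h.supportedBy_iff.2 subset_rfl

theorem FinitelySupported.supp_eq {x : X} (h : FinitelySupported 𝔸 x) :
    supp 𝔸 x = h.least := by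
  ext a
  exact ⟨fun ha => ha _ h.supportedBy_least, fun ha T hT => h.supportedBy_iff.1 hT ha⟩

theorem FinitelySupported.least_smul [DecidableEq 𝔸] {x : X} (h : FinitelySupported 𝔸 x)
    (π : FinPerm 𝔸) : (h.smul π).least = π • h.least := by
  refine subset_antisymm ((h.smul π).supportedBy_iff.1 (h.supportedBy_least.smul π)) ?_
  rw [Finset.smul_finset_subset_iff]
  refine h.supportedBy_iff.1 ?_
  have := (h.smul π).supportedBy_least.smul π⁻¹
  rwa [inv_smul_smul] at this

/-- An orbit contains only finitely many elements with a given finite support `T`: the element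
`π • x` depends only on the restriction of `π` to `supp x`, which takes values in `T`. -/
theorem finite_orbit_inter_supportedBy {x : X} (h : FinitelySupported 𝔸 x) (T : Finset 𝔸) :
    {y ∈ MulAction.orbit (FinPerm 𝔸) x | SupportedBy 𝔸 T y}.Finite := by
  classical
  have key : ∀ y : {y ∈ MulAction.orbit (FinPerm 𝔸) x | SupportedBy 𝔸 T y},
      ∃ f : h.least → T, ∃ π : FinPerm 𝔸, π • x = y ∧ ∀ a, (f a : 𝔸) = π • (a : 𝔸) := by
    rintro ⟨_, ⟨π, rfl⟩, hy⟩
    have h1 : π • h.least ⊆ T := by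
      rw [← h.least_smul]
      exact (h.smul π).supportedBy_iff.1 hy
    exact ⟨fun a => ⟨π • (a : 𝔸), h1 (Finset.smul_mem_smul_finset a.2)⟩, π, rfl, fun _ => rfl⟩
  choose f π hπ hf using key
  refine Set.finite_coe_iff.1 (Finite.of_injective f fun y z hyz => Subtype.ext ?_)
  rw [← hπ y, ← hπ z]
  exact h.supportedBy_least.smul_congr fun a ha => by
    rw [← hf y ⟨a, ha⟩, ← hf z ⟨a, ha⟩, hyz]
end Supports

/-! ### The spaces of `S`-orbits -/

section OpenSets

variable {𝔸 : Type} {X Y : NomTop.{u} 𝔸}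

theorem supportedBy_set_of_forall {S : Finset 𝔸} {Z : Type*} [MulAction (FinPerm 𝔸) Z] {U : Set Z}
    (h : ∀ π ∈ permFixing 𝔸 S, ∀ x ∈ U, π • x ∈ U) : SupportedBy 𝔸 S U := by
  refine supportedBy_of_forall fun π hπ => ?_
  ext x
  rw [Set.mem_smul_set_iff_inv_smul_mem]
  exact ⟨fun hx => by simpa using h π hπ _ hx, fun hx => h _ (inv_mem hπ) _ hx⟩

theorem SupportedBy.smul_mem {S : Finset 𝔸} {Z : Type*} [MulAction (FinPerm 𝔸) Z] {U : Set Z}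
    (h : SupportedBy 𝔸 S U) {π : FinPerm 𝔸} (hπ : π ∈ permFixing 𝔸 S) {x : Z} (hx : x ∈ U) :
    π • x ∈ U := by
  rw [← h.smul_eq hπ]
  exact Set.smul_mem_smul_set hx

/-- Openness is local among the finitely supported sets: a set supported by `S` is the union of
the `S`-supported family of all its open subsets. -/
theorem NomTop.mem_opens_of_locally {S : Finset 𝔸} {U : Set X} (hU : SupportedBy 𝔸 S U)
    (h : ∀ x ∈ U, ∃ V ∈ X.top.opens, x ∈ V ∧ V ⊆ U) : U ∈ X.top.opens := by
  have h1 : U = ⋃₀ {V ∈ X.top.opens | V ⊆ U} := by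
    refine subset_antisymm (fun x hx => ?_) (Set.sUnion_subset fun V hV => hV.2)
    obtain ⟨V, hV, hxV, hVU⟩ := h x hx
    exact ⟨V, ⟨hV, hVU⟩, hxV⟩
  rw [h1]
  refine X.top.sUnion_mem _ (fun V hV => hV.1) ⟨S, supportedBy_set_of_forall fun π hπ V hV => ?_⟩
  refine ⟨X.top.smul_mem π V hV.1, ?_⟩
  rw [← hU.smul_eq hπ]
  exact Set.smul_set_mono hV.2

end OpenSets

/-- The space of `S`-orbits of a nominal topological space `X`. It is a topological space in the
ordinary sense, whose open sets are the `S`-supported open sets of `X`. -/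
def OrbitSpace {𝔸 : Type} (X : NomTop.{u} 𝔸) (S : Finset 𝔸) : Type u :=
  MulAction.orbitRel.Quotient (permFixing 𝔸 S) X

namespace OrbitSpace

variable {𝔸 : Type} {X Y Z : NomTop.{u} 𝔸} {S : Finset 𝔸}

/-- The `S`-orbit of a point. -/
def mk (S : Finset 𝔸) (x : X) : OrbitSpace X S :=
  Quotient.mk'' x

theorem mk_surjective : Function.Surjective (mk S : X → OrbitSpace X S) :=
  Quotient.mk''_surjective

theorem mk_eq_mk {x y : X} : mk S x = mk S y ↔ ∃ π ∈ permFixing 𝔸 S, π • x = y := by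
  refine (Quotient.eq''.trans (MulAction.orbitRel_apply.trans ?_)).trans
    (?_ : x ∈ MulAction.orbit (permFixing 𝔸 S) y ↔ _)
  · rfl
  · constructor
    · rintro ⟨π, rfl⟩
      exact ⟨π⁻¹, inv_mem π.2, inv_smul_smul (π : FinPerm 𝔸) y⟩
    · rintro ⟨π, hπ, rfl⟩
      exact ⟨⟨π, hπ⟩⁻¹, inv_smul_smul π x⟩

theorem mk_smul {π : FinPerm 𝔸} (hπ : π ∈ permFixing 𝔸 S) (x : X) : mk S (π • x) = mk S x :=
  (mk_eq_mk.2 ⟨π, hπ, rfl⟩).symm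

theorem supportedBy_preimage_mk (W : Set (OrbitSpace X S)) : SupportedBy 𝔸 S (mk S ⁻¹' W) :=
  supportedBy_set_of_forall fun π hπ x hx => by
    rw [Set.mem_preimage, mk_smul hπ]
    exact hx

theorem preimage_image_mk {U : Set X} (hU : SupportedBy 𝔸 S U) : mk S ⁻¹' (mk S '' U) = U := by
  refine subset_antisymm ?_ (Set.subset_preimage_image _ _)
  rintro x ⟨y, hy, hxy⟩
  obtain ⟨π, hπ, rfl⟩ := mk_eq_mk.1 hxy
  exact hU.smul_mem hπ hy

instance : TopologicalSpace (OrbitSpace X S) where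
  IsOpen W := mk S ⁻¹' W ∈ X.top.opens
  isOpen_univ := X.top.univ_mem
  isOpen_inter V W hV hW := X.top.inter_mem _ hV _ hW
  isOpen_sUnion 𝒲 h := NomTop.mem_opens_of_locally (supportedBy_preimage_mk _) fun x hx => by
    obtain ⟨W, hW, hx⟩ := hx
    exact ⟨_, h W hW, hx, Set.preimage_mono (Set.subset_sUnion_of_mem hW)⟩

theorem isOpen_iff {W : Set (OrbitSpace X S)} : IsOpen W ↔ mk S ⁻¹' W ∈ X.top.opens :=
  Iff.rfl

/-- The map to the space of `S`-orbits is open: the saturation of an open set is the union of its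
translates by `Perm_S 𝔸`. -/
theorem isOpen_image_mk {U : Set X} (hU : U ∈ X.top.opens) : IsOpen (mk S '' U) := by
  refine NomTop.mem_opens_of_locally (supportedBy_preimage_mk _) ?_
  rintro x ⟨y, hy, hxy⟩
  obtain ⟨π, hπ, rfl⟩ := mk_eq_mk.1 hxy
  refine ⟨π • U, X.top.smul_mem π U hU, Set.smul_mem_smul_set hy, ?_⟩
  rintro _ ⟨z, hz, rfl⟩
  exact ⟨z, hz, (mk_smul hπ z).symm⟩

/-- The map of spaces of `S`-orbits induced by a continuous equivariant map. -/
def map (S : Finset 𝔸) (f : X ⟶ Y) : OrbitSpace X S → OrbitSpace Y S :=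
  Quotient.lift (fun x => mk S (f.toMap x)) fun x y h => by
    obtain ⟨π, hπ, rfl⟩ := mk_eq_mk.1 (Quotient.sound h : mk S x = mk S y)
    rw [map_smul, mk_smul hπ]

@[simp]
theorem map_mk (f : X ⟶ Y) (x : X) : map S f (mk S x) = mk S (f.toMap x) :=
  rfl

theorem continuous_map (f : X ⟶ Y) : Continuous (map S f) :=
  ⟨fun _ hW => f.continuous _ hW⟩

/-- A nominal topological space is compact iff all its spaces of orbits are: an orbit-finite set
of subsets has only finitely many `S`-supported members, and a cover supported by `S` has a
subcover meeting finitely many orbits as soon as finitely many saturations cover. -/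
theorem compact_iff [Infinite 𝔸] :
    X.Compact ↔ ∀ S : Finset 𝔸, CompactSpace (OrbitSpace X S) := by
  classical
  refine ⟨fun h S => ⟨isCompact_of_finite_subcover fun {ι} W hW hcov => ?_⟩,
    fun h 𝒞 h𝒞 hfs hcov => ?_⟩
  · obtain ⟨𝒟, h𝒟, ⟨-, hfin⟩, h𝒟c⟩ := h (Set.range fun i => mk S ⁻¹' W i)
      (Set.range_subset_iff.2 fun i => hW i)
      ⟨S, supportedBy_set_of_forall (by
        rintro π hπ _ ⟨i, rfl⟩
        exact ⟨i, ((supportedBy_preimage_mk (W i)).smul_eq hπ).symm⟩)⟩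
      (Set.eq_univ_of_forall fun x => by
        obtain ⟨i, hi⟩ := Set.mem_iUnion.1 (hcov (Set.mem_univ (mk S x)))
        exact ⟨_, ⟨i, rfl⟩, hi⟩)
    have hsupp : ∀ V ∈ 𝒟, SupportedBy 𝔸 S V := fun V hV => by
      obtain ⟨i, rfl⟩ := h𝒟 hV
      exact supportedBy_preimage_mk (W i)
    have h𝒟f : 𝒟.Finite := by
      refine (hfin.biUnion (t := fun O => {V ∈ O | SupportedBy 𝔸 S V}) ?_).subset fun V hV =>
        Set.mem_biUnion (Set.mem_image_of_mem _ hV) ⟨MulAction.mem_orbit_self V, hsupp V hV⟩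
      rintro _ ⟨V, hV, rfl⟩
      exact finite_orbit_inter_supportedBy ⟨S, hsupp V hV⟩ S
    choose i hi using h𝒟
    refine ⟨h𝒟f.toFinset.attach.image fun V => i (h𝒟f.mem_toFinset.1 V.2), fun o _ => ?_⟩
    obtain ⟨x, rfl⟩ := mk_surjective o
    obtain ⟨V, hV, hxV⟩ : x ∈ ⋃₀ 𝒟 := h𝒟c ▸ Set.mem_univ x
    refine Set.mem_biUnion (Finset.mem_coe.2
      (Finset.mem_image_of_mem _ (Finset.mem_attach _ ⟨V, h𝒟f.mem_toFinset.2 hV⟩))) ?_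
    rw [← hi hV] at hxV
    exact hxV
  obtain ⟨S, hS⟩ := hfs
  have := h S
  obtain ⟨t, ht, htf, htc⟩ := isCompact_univ.elim_finite_subcover_image (b := 𝒞)
    (c := fun U => mk S '' U) (fun U hU => isOpen_image_mk (h𝒞 hU)) (fun o _ => by
      obtain ⟨x, rfl⟩ := mk_surjective o
      have hx : x ∈ ⋃₀ 𝒞 := hcov ▸ Set.mem_univ x
      obtain ⟨U, hU, hxU⟩ := hx
      exact Set.mem_biUnion hU ⟨x, hxU, rfl⟩)
  refine ⟨{V | ∃ U ∈ t, ∃ π ∈ permFixing 𝔸 S, V = π • U}, ?_, ⟨⟨S, ?_⟩, ?_⟩, ?_⟩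
  · rintro _ ⟨U, hU, π, hπ, rfl⟩
    exact hS.smul_mem hπ (ht hU)
  · refine supportedBy_set_of_forall ?_
    rintro σ hσ _ ⟨U, hU, π, hπ, rfl⟩
    exact ⟨U, hU, σ * π, mul_mem hσ hπ, (mul_smul σ π U).symm⟩
  · refine (htf.image fun U => MulAction.orbit (FinPerm 𝔸) U).subset ?_
    rintro _ ⟨_, ⟨U, hU, π, _, rfl⟩, rfl⟩
    exact ⟨U, hU, (MulAction.orbit_smul _ _).symm⟩
  · refine Set.eq_univ_of_forall fun x => ?_
    obtain ⟨U, hU, y, hy, hyx⟩ := Set.mem_iUnion₂.1 (htc (Set.mem_univ (mk S x)))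
    obtain ⟨π, hπ, rfl⟩ := mk_eq_mk.1 hyx
    exact ⟨π • U, ⟨U, hU, π, hπ, rfl⟩, Set.smul_mem_smul_set hy⟩

theorem hausdorff_iff : X.Hausdorff ↔ ∀ S : Finset 𝔸, T2Space (OrbitSpace X S) := by
  have horb : ∀ (S : Finset 𝔸) (x y : X), orb 𝔸 S x ≠ orb 𝔸 S y ↔ mk S x ≠ mk S y := by
    intro S x y
    rw [not_iff_not, MulAction.orbit_eq_iff]
    refine Iff.trans ?_ mk_eq_mk.symm
    constructor
    · rintro ⟨π, rfl⟩
      exact ⟨(π : FinPerm 𝔸)⁻¹, inv_mem π.2, inv_smul_smul (π : FinPerm 𝔸) y⟩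
    · rintro ⟨π, hπ, rfl⟩
      exact ⟨⟨π, hπ⟩⁻¹, inv_smul_smul π x⟩
  constructor
  · intro h S
    refine ⟨fun o₁ o₂ hne => ?_⟩
    obtain ⟨x₁, rfl⟩ := mk_surjective o₁
    obtain ⟨x₂, rfl⟩ := mk_surjective o₂
    obtain ⟨U₁, hU₁, U₂, hU₂, hS₁, hS₂, hx₁, hx₂, hd⟩ := h S x₁ x₂ ((horb S x₁ x₂).2 hne)
    refine ⟨_, _, isOpen_image_mk hU₁, isOpen_image_mk hU₂, ⟨x₁, hx₁, rfl⟩, ⟨x₂, hx₂, rfl⟩, ?_⟩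
    rw [← Set.disjoint_preimage_iff mk_surjective, preimage_image_mk hS₁, preimage_image_mk hS₂]
    exact hd
  · intro h S x₁ x₂ hne
    have := h S
    obtain ⟨W₁, W₂, hW₁, hW₂, hx₁, hx₂, hd⟩ := t2_separation ((horb S x₁ x₂).1 hne)
    exact ⟨_, hW₁, _, hW₂, supportedBy_preimage_mk W₁, supportedBy_preimage_mk W₂, hx₁, hx₂,
      hd.preimage _⟩

end OrbitSpace

/-- A space has a basis of representable sets iff the representable neighbourhoods of each point
are a neighbourhood base. -/
theorem NomTop.exists_isBasis_representable_iff {𝔸 : Type} {X : NomTop.{u} 𝔸} :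
    (∃ ℬ : Set (Set X), (∀ B ∈ ℬ, X.Representable B) ∧ X.IsBasis ℬ) ↔
      ∀ U ∈ X.top.opens, ∀ x ∈ U, ∃ R, X.Representable R ∧ x ∈ R ∧ R ⊆ U := by
  constructor
  · rintro ⟨ℬ, hrep, ⟨-, -, hsub⟩, hfin⟩ U hU x hx
    obtain ⟨𝒰, -, h𝒰, rfl⟩ := hsub U hU
    obtain ⟨V, hV, hxV⟩ := hx
    obtain ⟨ℱ, hℱ, hℱf, rfl⟩ := h𝒰 V hV
    obtain ⟨𝒱, -, h𝒱, heq⟩ := hfin ℱ hℱ hℱf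
    have hx' : x ∈ ⋃₀ 𝒱 := heq ▸ hxV
    obtain ⟨R, hR, hxR⟩ := hx'
    refine ⟨R, hrep R (h𝒱 hR), hxR, ?_⟩
    exact (Set.subset_sUnion_of_mem hR).trans (heq ▸ Set.subset_sUnion_of_mem hV)
  · intro h
    have hop : ∀ R, X.Representable R → R ∈ X.top.opens := by
      rintro _ ⟨Y, f, A, -, hA, rfl⟩
      exact f.continuous A hA
    have hsm : ∀ (π : FinPerm 𝔸) R, X.Representable R → X.Representable (π • R) := by
      rintro π _ ⟨Y, f, A, hY, hA, rfl⟩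
      exact ⟨Y, f, π • A, hY, hA.smul π, smul_preimage _ _ _⟩
    have hun : ∀ U ∈ X.top.opens, FinitelySupported 𝔸 {R | X.Representable R ∧ R ⊆ U} ∧
        U = ⋃₀ {R | X.Representable R ∧ R ⊆ U} := by
      intro U hU
      constructor
      · obtain ⟨S, hS⟩ := X.top.finitelySupported U hU
        refine ⟨S, supportedBy_set_of_forall fun π hπ R hR => ⟨hsm π R hR.1, ?_⟩⟩
        rw [← hS.smul_eq hπ]
        exact Set.smul_set_mono hR.2
      · refine subset_antisymm (fun x hx => ?_) (Set.sUnion_subset fun R hR => hR.2)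
        obtain ⟨R, hR, hxR, hRU⟩ := h U hU x hx
        exact ⟨R, ⟨hR, hRU⟩, hxR⟩
    refine ⟨{R | X.Representable R}, fun _ hR => hR, ⟨hop, hsm, fun U hU =>
      ⟨_, (hun U hU).1, fun V hV => ⟨{V}, Set.singleton_subset_iff.2 hV.1, Set.finite_singleton V,
        (Set.sInter_singleton V).symm⟩, (hun U hU).2⟩⟩, fun ℱ hℱ hfin => ?_⟩
    have hint : ⋂₀ ℱ ∈ X.top.opens := by
      induction ℱ, hfin using Set.Finite.induction_on with
      | empty => simpa using X.top.univ_mem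
      | insert _ _ ih =>
        rw [Set.sInter_insert]
        exact X.top.inter_mem _ (hop _ (hℱ (Set.mem_insert _ _))) _
          (ih fun _ h => hℱ (Set.mem_insert_of_mem _ h))
    exact ⟨_, (hun _ hint).1, fun R hR => hR.1, (hun _ hint).2⟩

/-! ### Codirected limits of nominal topological spaces -/

/-- The least support of a point of a nominal topological space. -/
noncomputable def NomTop.support {𝔸 : Type} [Infinite 𝔸] {X : NomTop.{u} 𝔸} (x : X) : Finset 𝔸 :=
  (X.toNom.finitelySupported x).least

namespace NomTop

variable {𝔸 : Type} [Infinite 𝔸] {X Y : NomTop.{u} 𝔸}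

theorem supportedBy_iff {x : X} {S : Finset 𝔸} : SupportedBy 𝔸 S x ↔ support x ⊆ S :=
  FinitelySupported.supportedBy_iff _

theorem supportedBy_support (x : X) : SupportedBy 𝔸 (support x) x :=
  FinitelySupported.supportedBy_least _

theorem support_map_subset (f : X ⟶ Y) (x : X) : support (f.toMap x) ⊆ support x :=
  supportedBy_iff.1 ((supportedBy_support x).map f.toMap)

theorem support_smul [DecidableEq 𝔸] (π : FinPerm 𝔸) (x : X) :
    support (π • x) = π • support x :=
  FinitelySupported.least_smul _ π

theorem bounded_iff {k : ℕ} : X.toNom.Bounded k ↔ ∀ x : X, (support x).card ≤ k := by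
  refine forall_congr' fun x => ?_
  rw [(X.toNom.finitelySupported x).supp_eq, Set.encard_coe_eq_coe_finsetCard]
  exact_mod_cast Iff.rfl

end NomTop

open NomTop

section Codirected

variable {I : Type u} [Preorder I] {𝔸 : Type} {D : I ⥤ NomTop.{u} 𝔸}

theorem cone_w_apply (c : Cone D) {i j : I} (f : i ⟶ j) (p : c.pt) :
    (D.map f).toMap ((c.π.app i).toMap p) = (c.π.app j).toMap p :=
  congrArg (fun h : c.pt ⟶ D.obj j => h.toMap p) (c.w f)

variable (D) in
/-- A cone over a diagram of nominal topological spaces that is a limit cone on the level of points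
and whose topology is generated by the preimages of the open sets of the diagram. -/
structure IsConcreteLimit (c : Cone D) : Prop where
  existsUnique : ∀ x : ∀ i, D.obj i, (∀ {i j} (f : i ⟶ j), (D.map f).toMap (x i) = x j) →
    ∃! p : c.pt, ∀ i, (c.π.app i).toMap p = x i
  nhds : ∀ U ∈ c.pt.top.opens, ∀ p ∈ U, ∃ i, ∃ V ∈ (D.obj i).top.opens,
    (c.π.app i).toMap p ∈ V ∧ (c.π.app i).toMap ⁻¹' V ⊆ U

namespace IsConcreteLimit

variable {c : Cone D}

theorem ext (hc : IsConcreteLimit D c) {p q : c.pt}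
    (h : ∀ i, (c.π.app i).toMap p = (c.π.app i).toMap q) : p = q :=
  (hc.existsUnique (fun i => (c.π.app i).toMap q) fun f => cone_w_apply c f q).unique h fun _ => rfl

theorem nonempty_isLimit (hc : IsConcreteLimit D c) : Nonempty (IsLimit c) := by
  have hlift : ∀ (s : Cone D) (t : s.pt), ∃ p : c.pt,
      ∀ i, (c.π.app i).toMap p = (s.π.app i).toMap t := fun s t =>
    (hc.existsUnique (fun i => (s.π.app i).toMap t) fun f => cone_w_apply s f t).exists
  choose φ hφ using hlift
  refine ⟨⟨fun s => ⟨⟨φ s, fun π t => hc.ext fun i => ?_⟩, fun U hU => ?_⟩, fun s i => ?_,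
    fun s m hm => ?_⟩⟩
  · rw [map_smul, hφ, hφ, map_smul]
    rfl
  · obtain ⟨S, hS⟩ := c.pt.top.finitelySupported U hU
    refine NomTop.mem_opens_of_locally (S := S) (supportedBy_set_of_forall ?_) fun t ht => ?_
    · intro π hπ t ht
      rw [Set.mem_preimage, map_smul]
      exact hS.smul_mem hπ ht
    · obtain ⟨i, V, hV, htV, hVU⟩ := hc.nhds U hU _ ht
      refine ⟨_, (s.π.app i).continuous V hV, ?_, fun t' ht' => hVU ?_⟩
      · rw [Set.mem_preimage, ← hφ s t i]
        exact htV
      · rw [Set.mem_preimage, ← hφ s t' i] at ht'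
        exact ht'
  · refine NomTop.Hom.ext (MulActionHom.ext fun t => ?_)
    exact hφ s t i
  · refine NomTop.Hom.ext (MulActionHom.ext fun t => hc.ext fun i => ?_)
    refine Eq.trans ?_ (hφ s t i).symm
    exact congrArg (fun h : s.pt ⟶ D.obj i => h.toMap t) (hm i)

theorem of_iso (hc : IsConcreteLimit D c) {c' : Cone D} (e : c ≅ c') : IsConcreteLimit D c' := by
  have hw : ∀ i (p : c'.pt), (c.π.app i).toMap (e.inv.hom.toMap p) = (c'.π.app i).toMap p :=
    fun i p => congrArg (fun h : c'.pt ⟶ D.obj i => h.toMap p) (e.inv.w i)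
  have hw' : ∀ i (p : c.pt), (c'.π.app i).toMap (e.hom.hom.toMap p) = (c.π.app i).toMap p :=
    fun i p => congrArg (fun h : c.pt ⟶ D.obj i => h.toMap p) (e.hom.w i)
  have hinv : ∀ p : c'.pt, e.hom.hom.toMap (e.inv.hom.toMap p) = p := fun p =>
    congrArg (fun h : c' ⟶ c' => h.hom.toMap p) e.inv_hom_id
  constructor
  · intro x hx
    obtain ⟨p, hp, -⟩ := hc.existsUnique x hx
    refine ⟨e.hom.hom.toMap p, fun i => (hw' i p).trans (hp i), fun q hq => ?_⟩
    have h1 : e.inv.hom.toMap q = p := hc.ext fun i => by rw [hw, hq, hp]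
    rw [← h1, hinv]
  · intro U hU p hp
    obtain ⟨i, V, hV, hpV, hVU⟩ := hc.nhds _ (e.hom.hom.continuous U hU) (e.inv.hom.toMap p) (by
      rw [Set.mem_preimage, hinv]; exact hp)
    refine ⟨i, V, hV, by rwa [hw] at hpV, fun q hq => ?_⟩
    rw [Set.mem_preimage, ← hw] at hq
    have h1 := hVU hq
    rwa [Set.mem_preimage, hinv] at h1

end IsConcreteLimit

/-- The compatible families of a diagram of nominal topological spaces, with the componentwise
action of the finite permutations. -/
def Families (D : I ⥤ NomTop.{u} 𝔸) : Type u :=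
  {x : ∀ i, D.obj i // ∀ (i j : I) (f : i ⟶ j), (D.map f).toMap (x i) = x j}

instance (D : I ⥤ NomTop.{u} 𝔸) : MulAction (FinPerm 𝔸) (Families D) where
  smul π x := ⟨fun i => π • x.1 i, fun i j f => by rw [map_smul, x.2 i j f]⟩
  one_smul x := Subtype.ext (funext fun i => one_smul (FinPerm 𝔸) (x.1 i))
  mul_smul π σ x := Subtype.ext (funext fun i => mul_smul π σ (x.1 i))

variable [IsCodirectedOrder I] [Nonempty I]

/-- A finite partition of a codirected preorder has a coinitial part. -/
theorem exists_coinitial_fiber {F : Type*} [Finite F] (color : I → F) :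
    ∃ c, ∀ i, ∃ j ≤ i, color j = c := by
  by_contra! h
  choose g hg using h
  obtain ⟨j, hj⟩ := (Set.finite_range g).bddBelow
  exact hg (color j) j (hj ⟨_, rfl⟩) rfl

/-- In a codirected diagram of `k`-bounded spaces, the supports of the components of a compatible
family have a largest member: a support of maximal size. -/
theorem exists_support_max [Infinite 𝔸] {k : ℕ} (hb : ∀ i, (D.obj i).toNom.Bounded k)
    {x : ∀ i, D.obj i} (hx : ∀ {i j} (f : i ⟶ j), (D.map f).toMap (x i) = x j) :
    ∃ i, ∀ j, support (x j) ⊆ support (x i) := by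
  obtain ⟨i, hi⟩ : ∃ i, ∀ j, (support (x j)).card ≤ (support (x i)).card := by
    have hbdd : BddAbove (Set.range fun i => (support (x i)).card) :=
      ⟨k, by rintro _ ⟨i, rfl⟩; exact bounded_iff.1 (hb i) (x i)⟩
    obtain ⟨i, hi⟩ := Nat.sSup_mem (Set.range_nonempty _) hbdd
    exact ⟨i, fun j => (le_csSup hbdd ⟨j, rfl⟩).trans_eq hi.symm⟩
  refine ⟨i, fun j => ?_⟩
  obtain ⟨l, hli, hlj⟩ := exists_le_le i j
  have h1 : support (x i) ⊆ support (x l) := by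
    rw [← hx (homOfLE hli)]
    exact support_map_subset _ _
  rw [Finset.eq_of_subset_of_card_le h1 (hi l), ← hx (homOfLE hlj)]
  exact support_map_subset _ _

/-- The topology on the compatible families generated by the preimages of the open sets of the
members of the diagram. -/
def Families.topology (D : I ⥤ NomTop.{u} 𝔸) : NomTopology 𝔸 (Families D) where
  opens := {U | FinitelySupported 𝔸 U ∧ ∀ x ∈ U, ∃ i, ∃ V ∈ (D.obj i).top.opens,
    x.1 i ∈ V ∧ ∀ y : Families D, y.1 i ∈ V → y ∈ U}
  finitelySupported U hU := hU.1
  smul_mem π U hU := by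
    refine ⟨hU.1.smul π, ?_⟩
    rintro _ ⟨x, hx, rfl⟩
    obtain ⟨i, V, hV, hxV, hVU⟩ := hU.2 x hx
    refine ⟨i, π • V, (D.obj i).top.smul_mem π V hV, Set.smul_mem_smul_set hxV, fun y hy => ?_⟩
    rw [Set.mem_smul_set_iff_inv_smul_mem] at hy ⊢
    exact hVU _ hy
  sUnion_mem 𝒰 h𝒰 hfs := by
    refine ⟨hfs.sUnion, ?_⟩
    rintro x ⟨U, hU, hx⟩
    obtain ⟨i, V, hV, hxV, hVU⟩ := (h𝒰 hU).2 x hx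
    exact ⟨i, V, hV, hxV, fun y hy => ⟨U, hU, hVU y hy⟩⟩
  univ_mem := ⟨finitelySupported_univ, fun _ _ => ⟨Classical.arbitrary I, Set.univ,
    (D.obj _).top.univ_mem, trivial, fun _ _ => trivial⟩⟩
  inter_mem U hU U' hU' := by
    refine ⟨hU.1.inter hU'.1, fun x hx => ?_⟩
    obtain ⟨i, V, hV, hxV, hVU⟩ := hU.2 x hx.1
    obtain ⟨j, W, hW, hxW, hWU⟩ := hU'.2 x hx.2
    obtain ⟨l, hli, hlj⟩ := exists_le_le i j
    have h1 := fun y : Families D => y.2 _ _ (homOfLE hli)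
    have h2 := fun y : Families D => y.2 _ _ (homOfLE hlj)
    refine ⟨l, _, (D.obj l).top.inter_mem _ ((D.map (homOfLE hli)).continuous V hV) _
      ((D.map (homOfLE hlj)).continuous W hW), ⟨?_, ?_⟩, fun y hy => ⟨hVU y ?_, hWU y ?_⟩⟩
    · rw [Set.mem_preimage, h1]; exact hxV
    · rw [Set.mem_preimage, h2]; exact hxW
    · rw [← h1 y]; exact hy.1
    · rw [← h2 y]; exact hy.2

/-- A codirected diagram of `k`-bounded spaces has a concrete limit. The bound makes all compatible
families finitely supported. -/
theorem exists_isConcreteLimit [Infinite 𝔸] {k : ℕ} (D : I ⥤ NomTop.{u} 𝔸)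
    (hb : ∀ i, (D.obj i).toNom.Bounded k) : ∃ c : Cone D, IsConcreteLimit D c := by
  have hfs : ∀ x : Families D, FinitelySupported 𝔸 x := fun x => by
    obtain ⟨i, hi⟩ := exists_support_max hb (x.2 _ _)
    exact ⟨support (x.1 i), supportedBy_of_forall fun π hπ => Subtype.ext (funext fun j =>
      (supportedBy_iff.2 (hi j)).smul_eq hπ)⟩
  let L : NomTop.{u} 𝔸 := ⟨⟨Families D, hfs⟩, Families.topology D⟩
  let pr : ∀ i, L ⟶ D.obj i := fun i => NomTop.Hom.mk ⟨fun x : Families D => x.1 i, fun _ _ => rfl⟩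
    fun U hU => by
      obtain ⟨S, hS⟩ := (D.obj i).top.finitelySupported U hU
      exact ⟨⟨S, supportedBy_set_of_forall fun π hπ x hx => hS.smul_mem hπ hx⟩,
        fun x hx => ⟨i, U, hU, hx, fun _ hy => hy⟩⟩
  refine ⟨⟨L, ⟨pr, fun i j f => ?_⟩⟩, fun x hx => ?_, fun U hU x hx => hU.2 x hx⟩
  · exact NomTop.Hom.ext (MulActionHom.ext fun x : Families D => (x.2 i j f).symm)
  · refine ⟨(⟨x, fun _ _ f => hx f⟩ : Families D), fun _ => rfl, fun q hq => ?_⟩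
    exact Subtype.ext (funext hq)

theorem IsConcreteLimit.of_isLimit [Infinite 𝔸] {k : ℕ} {c : Cone D}
    (hc : IsLimit c) (hb : ∀ i, (D.obj i).toNom.Bounded k) : IsConcreteLimit D c := by
  obtain ⟨c', hc'⟩ := exists_isConcreteLimit D hb
  obtain ⟨hl⟩ := hc'.nonempty_isLimit
  exact hc'.of_iso (hl.uniqueUpToIso hc)

end Codirected

/-! ### Codirected limits of bounded nominal Stone spaces -/

theorem NomTop.Representable.preimage {𝔸 : Type} {X Y : NomTop.{u} 𝔸} {R : Set Y}
    (hR : Y.Representable R) (f : X ⟶ Y) : X.Representable (f.toMap ⁻¹' R) := by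
  obtain ⟨Z, g, A, hZ, hA, rfl⟩ := hR
  exact ⟨Z, f ≫ g, A, hZ, hA, rfl⟩

theorem OrbitSpace.map_comp {𝔸 : Type} {X Y Z : NomTop.{u} 𝔸} {S : Finset 𝔸} (f : X ⟶ Y)
    (g : Y ⟶ Z) (o : OrbitSpace X S) : map S (f ≫ g) o = map S g (map S f o) := by
  obtain ⟨x, rfl⟩ := mk_surjective o
  rfl

theorem OrbitSpace.map_id {𝔸 : Type} {X : NomTop.{u} 𝔸} {S : Finset 𝔸} (o : OrbitSpace X S) :
    map S (𝟙 X) o = o := by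
  obtain ⟨x, rfl⟩ := mk_surjective o
  rfl

namespace IsConcreteLimit

variable {I : Type u} [Preorder I] [IsCodirectedOrder I] [Nonempty I] {𝔸 : Type} [Infinite 𝔸]
  {D : I ⥤ NomTop.{u} 𝔸} {c : Cone D} {k : ℕ}

theorem exists_support_eq (hc : IsConcreteLimit D c) (hb : ∀ i, (D.obj i).toNom.Bounded k)
    (p : c.pt) : ∃ i, support ((c.π.app i).toMap p) = support p := by
  obtain ⟨i, hi⟩ := exists_support_max hb (x := fun i => (c.π.app i).toMap p)
    fun f => cone_w_apply c f p
  refine ⟨i, subset_antisymm (support_map_subset _ _) (supportedBy_iff.1 ?_)⟩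
  refine supportedBy_of_forall fun π hπ => hc.ext fun j => ?_
  rw [map_smul]
  exact (supportedBy_iff.2 (hi j)).smul_eq hπ

theorem bounded (hc : IsConcreteLimit D c) (hb : ∀ i, (D.obj i).toNom.Bounded k) :
    c.pt.toNom.Bounded k := by
  refine bounded_iff.2 fun p => ?_
  obtain ⟨i, hi⟩ := hc.exists_support_eq hb p
  rw [← hi]
  exact bounded_iff.1 (hb i) _

/-- Points of a limit whose components lie in the same `S`-orbits lie in the same `S`-orbit. The
translates `τ • q` matching `p` in a given component form, far enough down the diagram, a finite set
since their supports lie in that of `p`; so one of them matches `p` in all components. -/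
theorem mk_eq_mk (hc : IsConcreteLimit D c) (hb : ∀ i, (D.obj i).toNom.Bounded k)
    {S : Finset 𝔸} {p q : c.pt}
    (h : ∀ i, OrbitSpace.mk S ((c.π.app i).toMap p) = OrbitSpace.mk S ((c.π.app i).toMap q)) :
    OrbitSpace.mk S p = OrbitSpace.mk S q := by
  classical
  obtain ⟨i₀, hi₀⟩ := hc.exists_support_eq hb q
  have key : ∀ i, ∃ r : {r ∈ MulAction.orbit (FinPerm 𝔸) q | SupportedBy 𝔸 (support p) r},
      OrbitSpace.mk S r.1 = OrbitSpace.mk S q ∧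
        (c.π.app i).toMap r.1 = (c.π.app i).toMap p := by
    intro i
    obtain ⟨j, hji, hj₀⟩ := exists_le_le i i₀
    obtain ⟨τ, hτ, hτj⟩ := OrbitSpace.mk_eq_mk.1 (h j).symm
    have hjq : support ((c.π.app j).toMap q) = support q := by
      refine subset_antisymm (support_map_subset _ _) ?_
      rw [← hi₀, ← cone_w_apply c (homOfLE hj₀)]
      exact support_map_subset _ _
    refine ⟨⟨τ • q, ⟨τ, rfl⟩, supportedBy_iff.2 ?_⟩, OrbitSpace.mk_smul hτ q, ?_⟩
    · rw [support_smul, ← hjq, ← support_smul, hτj]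
      exact support_map_subset _ _
    · rw [← cone_w_apply c (homOfLE hji), ← cone_w_apply c (homOfLE hji), map_smul, hτj]
  choose r hr hrp using key
  have : Finite {r ∈ MulAction.orbit (FinPerm 𝔸) q | SupportedBy 𝔸 (support p) r} :=
    (finite_orbit_inter_supportedBy (c.pt.toNom.finitelySupported q) _).to_subtype
  obtain ⟨r₀, hr₀⟩ := exists_coinitial_fiber r
  have : r₀.1 = p := hc.ext fun i => by
    obtain ⟨j, hji, rfl⟩ := hr₀ i
    rw [← cone_w_apply c (homOfLE hji), hrp, cone_w_apply c (homOfLE hji)]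
  obtain ⟨j, -, hj⟩ := hr₀ i₀
  rw [← this, ← hj, hr]

/-- A compatible family of `S`-orbits in a codirected diagram of `k`-bounded spaces comes from a
point of the limit. If `T` is the support of a point of maximal support size in these orbits, then
the points in the orbits with supports in `T` form a codirected diagram of nonempty finite sets. -/
theorem exists_mk_eq (hc : IsConcreteLimit D c) (hb : ∀ i, (D.obj i).toNom.Bounded k)
    {S : Finset 𝔸} {o : ∀ i, OrbitSpace (D.obj i) S}
    (ho : ∀ {i j} (f : i ⟶ j), OrbitSpace.map S (D.map f) (o i) = o j) :
    ∃ p : c.pt, ∀ i, OrbitSpace.mk S ((c.π.app i).toMap p) = o i := by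
  classical
  obtain ⟨i₀, x₀, hx₀, hmax⟩ : ∃ i₀, ∃ x₀ : D.obj i₀, OrbitSpace.mk S x₀ = o i₀ ∧
      ∀ j (y : D.obj j), OrbitSpace.mk S y = o j → (support y).card ≤ (support x₀).card := by
    let N : Set ℕ := {n | ∃ i, ∃ x : D.obj i, OrbitSpace.mk S x = o i ∧ (support x).card = n}
    have hbdd : BddAbove N := ⟨k, by rintro _ ⟨i, x, -, rfl⟩; exact bounded_iff.1 (hb i) x⟩
    have hne : N.Nonempty := by
      let i := Classical.arbitrary I
      obtain ⟨x, hx⟩ := OrbitSpace.mk_surjective (o i)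
      exact ⟨_, i, x, hx, rfl⟩
    obtain ⟨i, x, hx, hcard⟩ := Nat.sSup_mem hne hbdd
    exact ⟨i, x, hx, fun j y hy => (le_csSup hbdd ⟨j, y, hy, rfl⟩).trans_eq hcard.symm⟩
  let G : I ⥤ Type u :=
    { obj := fun i =>
        {x : D.obj i // OrbitSpace.mk S x = o i ∧ SupportedBy 𝔸 (support x₀) x}
      map := fun {i j} f => TypeCat.ofHom fun x => ⟨(D.map f).toMap x.1, by
        rw [← OrbitSpace.map_mk, x.2.1, ho f], x.2.2.map _⟩
      map_id := fun i => by
        ext x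
        exact congrArg (fun h : D.obj i ⟶ D.obj i => h.toMap x.1) (D.map_id i)
      map_comp := fun {i j l} f g => by
        ext x
        exact congrArg (fun h : D.obj i ⟶ D.obj l => h.toMap x.1) (D.map_comp f g) }
  have hfin : ∀ i, Finite (G.obj i) := fun i => by
    obtain ⟨x, hx⟩ := OrbitSpace.mk_surjective (o i)
    refine Set.Finite.to_subtype ((finite_orbit_inter_supportedBy
      ((D.obj i).toNom.finitelySupported x) (support x₀)).subset ?_)
    rintro y ⟨hy, hyT⟩
    obtain ⟨π, -, rfl⟩ := OrbitSpace.mk_eq_mk.1 (hx.trans hy.symm)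
    exact ⟨⟨π, rfl⟩, hyT⟩
  have hne : ∀ i, Nonempty (G.obj i) := fun i => by
    obtain ⟨j, hji, hj₀⟩ := exists_le_le i i₀
    obtain ⟨y, hy⟩ := OrbitSpace.mk_surjective (o j)
    have h1 : OrbitSpace.mk S ((D.map (homOfLE hj₀)).toMap y) = OrbitSpace.mk S x₀ := by
      rw [← OrbitSpace.map_mk, hy, ho, hx₀]
    obtain ⟨π, hπ, hπy⟩ := OrbitSpace.mk_eq_mk.1 h1
    have hπy' : OrbitSpace.mk S (π • y) = o j := (OrbitSpace.mk_smul hπ y).trans hy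
    have h2 : support x₀ ⊆ support (π • y) := by
      rw [← hπy, ← map_smul]
      exact support_map_subset _ _
    have h3 := Finset.eq_of_subset_of_card_le h2 (hmax j _ hπy')
    refine ⟨⟨(D.map (homOfLE hji)).toMap (π • y), ?_, supportedBy_iff.2 ?_⟩⟩
    · rw [← OrbitSpace.map_mk, hπy', ho]
    · rw [h3]
      exact support_map_subset _ _
  obtain ⟨x, hx⟩ := nonempty_sections_of_finite_cofiltered_system G
  obtain ⟨p, hp, -⟩ := hc.existsUnique (fun i => (x i).1) fun f => congrArg Subtype.val (hx f)
  exact ⟨p, fun i => by rw [hp]; exact (x i).2.1⟩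

/-- The space of `S`-orbits of a limit is embedded into the product of the spaces of `S`-orbits. -/
theorem isEmbedding_orbitSpace (hc : IsConcreteLimit D c) (hb : ∀ i, (D.obj i).toNom.Bounded k)
    (S : Finset 𝔸) : Topology.IsEmbedding fun (o : OrbitSpace c.pt S) (i : I) =>
      OrbitSpace.map S (c.π.app i) o := by
  have hcont : Continuous fun (o : OrbitSpace c.pt S) (i : I) => OrbitSpace.map S (c.π.app i) o :=
    continuous_pi fun i => OrbitSpace.continuous_map _
  refine ⟨⟨le_antisymm hcont.le_induced fun W hW => ?_⟩, fun o₁ o₂ h => ?_⟩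
  · refine (@isOpen_iff_forall_mem_open _ (TopologicalSpace.induced _ _) W).2 fun o ho => ?_
    obtain ⟨p, rfl⟩ := OrbitSpace.mk_surjective o
    obtain ⟨i, V, hV, hpV, hVU⟩ := hc.nhds _ (OrbitSpace.isOpen_iff.1 hW) p ho
    refine ⟨(fun (o : OrbitSpace c.pt S) (i : I) => OrbitSpace.map S (c.π.app i) o) ⁻¹'
      ((fun o => o i) ⁻¹' (OrbitSpace.mk S '' V)), ?_, isOpen_induced
        ((OrbitSpace.isOpen_image_mk (S := S) hV).preimage (continuous_apply i)), ⟨_, hpV, rfl⟩⟩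
    rintro o' ⟨y, hy, hyo⟩
    obtain ⟨q, rfl⟩ := OrbitSpace.mk_surjective o'
    obtain ⟨π, hπ, hπq⟩ := OrbitSpace.mk_eq_mk.1 hyo.symm
    have h1 : π • q ∈ (c.π.app i).toMap ⁻¹' V := by
      rw [Set.mem_preimage, map_smul, hπq]
      exact hy
    rw [← OrbitSpace.mk_smul hπ q]
    exact hVU h1
  · obtain ⟨p, rfl⟩ := OrbitSpace.mk_surjective o₁
    obtain ⟨q, rfl⟩ := OrbitSpace.mk_surjective o₂
    exact hc.mk_eq_mk hb fun i => congrFun h i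

/-- The space of `S`-orbits of the limit is the closed subspace of the compatible families in a
product of compact Hausdorff spaces. -/
theorem isStone (hc : IsConcreteLimit D c) (hb : ∀ i, (D.obj i).toNom.Bounded k)
    (hs : ∀ i, (D.obj i).IsStone) : c.pt.IsStone := by
  have hcomp : ∀ i S, CompactSpace (OrbitSpace (D.obj i) S) := fun i =>
    OrbitSpace.compact_iff.1 (hs i).1
  have hT2 : ∀ i S, T2Space (OrbitSpace (D.obj i) S) := fun i =>
    OrbitSpace.hausdorff_iff.1 (hs i).2.1
  refine ⟨OrbitSpace.compact_iff.2 fun S => ?_, OrbitSpace.hausdorff_iff.2 fun S => ?_,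
    exists_isBasis_representable_iff.2 fun U hU p hp => ?_⟩
  · refine Topology.IsClosedEmbedding.compactSpace
      (f := fun (o : OrbitSpace c.pt S) (i : I) => OrbitSpace.map S (c.π.app i) o)
      ⟨hc.isEmbedding_orbitSpace hb S, ?_⟩
    have hrange : Set.range (fun (o : OrbitSpace c.pt S) (i : I) =>
        OrbitSpace.map S (c.π.app i) o) =
          ⋂ (i) (j) (f : i ⟶ j), {o | OrbitSpace.map S (D.map f) (o i) = o j} := by
      ext o
      simp only [Set.mem_iInter, Set.mem_ofPred_eq]
      constructor
      · rintro ⟨o, rfl⟩ i j f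
        rw [← OrbitSpace.map_comp, c.w]
      · intro ho
        obtain ⟨p, hp⟩ := hc.exists_mk_eq hb (o := o) fun f => ho _ _ f
        exact ⟨OrbitSpace.mk S p, funext hp⟩
    rw [hrange]
    exact isClosed_iInter fun i => isClosed_iInter fun j => isClosed_iInter fun f =>
      isClosed_eq ((OrbitSpace.continuous_map _).comp (continuous_apply i)) (continuous_apply j)
  · exact (hc.isEmbedding_orbitSpace hb S).t2Space
  · obtain ⟨i, V, hV, hpV, hVU⟩ := hc.nhds U hU p hp
    obtain ⟨R, hR, hpR, hRV⟩ := exists_isBasis_representable_iff.1 (hs i).2.2 V hV _ hpV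
    exact ⟨_, hR.preimage (c.π.app i), hpR, (Set.preimage_mono hRV).trans hVU⟩

/-- An equivariant open set that contains the image of the limit in a member of a codirected diagram
of bounded Stone spaces already contains the image of some member of the diagram. -/
theorem exists_hom_forall_mem (hc : IsConcreteLimit D c) (hb : ∀ i, (D.obj i).toNom.Bounded k)
    (hs : ∀ i, (D.obj i).IsStone) {i : I} {W : Set (D.obj i)} (hW : W ∈ (D.obj i).top.opens)
    (hWe : ∀ (π : FinPerm 𝔸), ∀ x ∈ W, π • x ∈ W) (h : ∀ p : c.pt, (c.π.app i).toMap p ∈ W) :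
    ∃ (j : I) (f : j ⟶ i), ∀ x : D.obj j, (D.map f).toMap x ∈ W := by
  by_contra! hne
  have hcomp : ∀ i S, CompactSpace (OrbitSpace (D.obj i) S) := fun i =>
    OrbitSpace.compact_iff.1 (hs i).1
  have hT2 : ∀ i S, T2Space (OrbitSpace (D.obj i) S) := fun i =>
    OrbitSpace.hausdorff_iff.1 (hs i).2.1
  have hWsat : OrbitSpace.mk ∅ ⁻¹' (OrbitSpace.mk ∅ '' W) = W :=
    OrbitSpace.preimage_image_mk (supportedBy_set_of_forall fun π _ => hWe π)
  -- The orbits outside `W` form a codirected diagram of compact Hausdorff spaces. Indices `j`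
  -- without a map to `i` are left unconstrained.
  let K : ∀ j, Set (OrbitSpace (D.obj j) ∅) := fun j =>
    {o | ∀ f : j ⟶ i, OrbitSpace.map ∅ (D.map f) o ∉ OrbitSpace.mk ∅ '' W}
  have hKmap : ∀ {j l} (f : j ⟶ l), ∀ o ∈ K j, OrbitSpace.map ∅ (D.map f) o ∈ K l := by
    intro j l f o ho g
    rw [← OrbitSpace.map_comp, ← D.map_comp]
    exact ho (f ≫ g)
  have hKclosed : ∀ j, IsClosed (K j) := fun j => by
    have : K j = ⋂ f : j ⟶ i, (OrbitSpace.map ∅ (D.map f) ⁻¹' (OrbitSpace.mk ∅ '' W))ᶜ := by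
      ext o
      simp [K]
    rw [this]
    exact isClosed_iInter fun f =>
      ((OrbitSpace.isOpen_image_mk hW).preimage (OrbitSpace.continuous_map _)).isClosed_compl
  let G : I ⥤ TopCat.{u} :=
    { obj := fun j => TopCat.of (K j)
      map := fun {j l} f => TopCat.ofHom ⟨fun o => ⟨OrbitSpace.map ∅ (D.map f) o.1, hKmap f _ o.2⟩,
        ((OrbitSpace.continuous_map _).comp continuous_subtype_val).subtype_mk _⟩
      map_id := fun j => by
        ext o
        change OrbitSpace.map ∅ (D.map (𝟙 j)) o.1 = o.1
        rw [D.map_id, OrbitSpace.map_id]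
      map_comp := fun {j l m} f g => by
        ext o
        change OrbitSpace.map ∅ (D.map (f ≫ g)) o.1 =
          OrbitSpace.map ∅ (D.map g) (OrbitSpace.map ∅ (D.map f) o.1)
        rw [D.map_comp, OrbitSpace.map_comp] }
  have h1 : ∀ j, CompactSpace (G.obj j) := fun j =>
    isCompact_iff_compactSpace.1 (hKclosed j).isCompact
  have h2 : ∀ j, T2Space (G.obj j) := fun j => inferInstanceAs (T2Space (K j))
  have h3 : ∀ j, Nonempty (G.obj j) := fun j => by
    obtain ⟨l, hlj, hli⟩ := exists_le_le j i
    obtain ⟨x, hx⟩ := hne l (homOfLE hli)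
    refine ⟨⟨OrbitSpace.map ∅ (D.map (homOfLE hlj)) (OrbitSpace.mk ∅ x), hKmap _ _ fun f hf => ?_⟩⟩
    rw [OrbitSpace.map_mk, ← Set.mem_preimage, hWsat] at hf
    exact hx hf
  obtain ⟨o, ho⟩ := TopCat.nonempty_limitCone_of_compact_t2_cofiltered_system.{u, u} G
  obtain ⟨p, hp⟩ := hc.exists_mk_eq hb (o := fun j => (o j).1) fun f => congrArg Subtype.val (ho f)
  refine (o i).2 (𝟙 i) ?_
  rw [D.map_id, OrbitSpace.map_id, ← hp]
  exact ⟨_, h p, rfl⟩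

end IsConcreteLimit

/-! ### Maps into discrete spaces -/

section Discrete

variable {𝔸 : Type} {X : NomTop.{u} 𝔸} {Y : NomSet.{u} 𝔸}

theorem NomTop.mem_opens_of_equivariant {U : Set X} (hU : ∀ (π : FinPerm 𝔸), ∀ x ∈ U, π • x ∈ U)
    (h : ∀ x ∈ U, ∃ V ∈ X.top.opens, x ∈ V ∧ V ⊆ U) : U ∈ X.top.opens :=
  mem_opens_of_locally (S := ∅) (supportedBy_set_of_forall fun π _ => hU π) h

/-- A locally constant equivariant map is continuous for the discrete topology. -/
def homDiscrete (f : X →[FinPerm 𝔸] Y)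
    (hf : ∀ x, ∃ V ∈ X.top.opens, x ∈ V ∧ ∀ y ∈ V, f y = f x) : X ⟶ (discrete 𝔸).obj Y :=
  NomTop.Hom.mk (Y := (discrete 𝔸).obj Y) f fun A hA => by
    obtain ⟨S, hS⟩ := FinitelySupported.preimage f hA
    refine mem_opens_of_locally hS fun x hx => ?_
    obtain ⟨V, hV, hxV, hVf⟩ := hf x
    exact ⟨V, hV, hxV, fun y hy => (congrArg (· ∈ A) (hVf y hy)).mpr hx⟩

theorem preimage_singleton_mem_opens (f : X ⟶ (discrete 𝔸).obj Y) (y : Y) :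
    f.toMap ⁻¹' {y} ∈ X.top.opens :=
  f.continuous _ (Y.finitelySupported y).singleton

instance (S : Finset 𝔸) : DiscreteTopology (OrbitSpace ((discrete 𝔸).obj Y) S) :=
  discreteTopology_iff_forall_isOpen.2 fun W =>
    ⟨S, OrbitSpace.supportedBy_preimage_mk W⟩

/-- A discrete continuous image of a compact space is orbit-finite: its space of orbits is compact
and discrete. -/
theorem orbitFinite_of_surjective [Infinite 𝔸] (hX : X.Compact) (f : X ⟶ (discrete 𝔸).obj Y)
    (hf : Function.Surjective f.toMap) : Y.OrbitFinite := by
  have := OrbitSpace.compact_iff.1 hX ∅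
  have h1 : Function.Surjective (OrbitSpace.map ∅ f) := fun o => by
    obtain ⟨y, rfl⟩ := OrbitSpace.mk_surjective o
    obtain ⟨x, rfl⟩ := hf y
    exact ⟨OrbitSpace.mk ∅ x, rfl⟩
  have h2 : CompactSpace (OrbitSpace ((discrete 𝔸).obj Y) ∅) :=
    h1.compactSpace (OrbitSpace.continuous_map f)
  have h3 : Finite (OrbitSpace ((discrete 𝔸).obj Y) ∅) := finite_of_compact_of_discrete
  refine Finite.of_surjective (α := OrbitSpace ((discrete 𝔸).obj Y) ∅)
    (Quotient.lift
      (fun y : Y => (Quotient.mk'' y : MulAction.orbitRel.Quotient (FinPerm 𝔸) Y)) ?_) ?_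
  · intro y z h
    obtain ⟨π, -, rfl⟩ := OrbitSpace.mk_eq_mk.1 (Quotient.sound h : OrbitSpace.mk
      (X := (discrete 𝔸).obj Y) ∅ y = OrbitSpace.mk ∅ z)
    exact (Quotient.sound (MulAction.orbitRel_apply.2 ⟨π, rfl⟩)).symm
  · intro o
    induction o using Quotient.inductionOn' with
    | h y => exact ⟨OrbitSpace.mk (X := (discrete 𝔸).obj Y) ∅ y, rfl⟩

theorem bounded_of_surjective [Infinite 𝔸] {k : ℕ} (hX : X.toNom.Bounded k)
    (f : X ⟶ (discrete 𝔸).obj Y) (hf : Function.Surjective f.toMap) : Y.Bounded k := by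
  refine bounded_iff (X := (discrete 𝔸).obj Y).2 fun y => ?_
  obtain ⟨x, rfl⟩ := hf y
  exact (Finset.card_le_card (support_map_subset f x)).trans (bounded_iff.1 hX x)

end Discrete

/-! ### Open congruences -/

/-- An open congruence on a nominal topological space: an equivariant equivalence relation with open
equivalence classes. Its quotient is a discrete quotient of the space. -/
structure OpenCongr {𝔸 : Type} (X : NomTop.{u} 𝔸) : Type u extends Setoid X where
  smul : ∀ (π : FinPerm 𝔸) (x y : X), toSetoid x y → toSetoid (π • x) (π • y)
  isOpen : ∀ x, {y | toSetoid x y} ∈ X.top.opens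

namespace OpenCongr

variable {𝔸 : Type} {X Y : NomTop.{u} 𝔸}

/-- Finer congruences are smaller, so that a relation `r ≤ s` induces a map from the quotient by `r`
to the quotient by `s`. -/
instance : Preorder (OpenCongr X) := Preorder.lift OpenCongr.toSetoid

instance : Nonempty (OpenCongr X) :=
  ⟨⟨⊤, fun _ _ _ _ => trivial, fun _ => X.top.univ_mem⟩⟩

theorem exists_le_inf (r s : OpenCongr X) : ∃ t : OpenCongr X, t ≤ r ∧ t ≤ s :=
  ⟨⟨r.toSetoid ⊓ s.toSetoid, fun π x y h => ⟨r.smul π x y h.1, s.smul π x y h.2⟩,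
    fun x => X.top.inter_mem _ (r.isOpen x) _ (s.isOpen x)⟩, fun _ _ h => h.1, fun _ _ h => h.2⟩

instance : IsCodirectedOrder (OpenCongr X) :=
  ⟨exists_le_inf⟩

/-- The inverse image of an open congruence. -/
def comap (f : X ⟶ Y) (r : OpenCongr Y) : OpenCongr X where
  toSetoid := r.toSetoid.comap f.toMap
  smul π x y h := by
    change r.toSetoid _ _
    rw [map_smul, map_smul]
    exact r.smul π _ _ h
  isOpen x := f.continuous _ (r.isOpen (f.toMap x))

/-- The kernel of a continuous equivariant map into a discrete space. -/
def ker {Y : NomSet.{u} 𝔸} (f : X ⟶ (discrete 𝔸).obj Y) : OpenCongr X where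
  toSetoid := Setoid.ker f.toMap
  smul π x y h := by
    change f.toMap (π • x) = f.toMap (π • y)
    rw [map_smul, map_smul]
    exact congrArg (π • ·) h
  isOpen x := by
    convert preimage_singleton_mem_opens f (f.toMap x) using 1
    ext y
    exact eq_comm

variable (r : OpenCongr X)

instance : MulAction (FinPerm 𝔸) (Quotient r.toSetoid) where
  smul π := Quotient.map (π • ·) (r.smul π)
  one_smul q := by
    induction q using Quotient.inductionOn with
    | h x => exact congrArg _ (one_smul (FinPerm 𝔸) x)
  mul_smul π σ q := by
    induction q using Quotient.inductionOn with
    | h x => exact congrArg _ (mul_smul π σ x)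

/-- The quotient of a space by an open congruence as a nominal set. -/
def quotient : NomSet.{u} 𝔸 where
  carrier := Quotient r.toSetoid
  finitelySupported q := by
    induction q using Quotient.inductionOn with
    | h x =>
      obtain ⟨S, hS⟩ := X.toNom.finitelySupported x
      exact ⟨S, fun π hπ => congrArg (Quotient.mk r.toSetoid) (hS π hπ)⟩

/-- The projection of a space onto its quotient by an open congruence. -/
def proj : X ⟶ (discrete 𝔸).obj r.quotient :=
  homDiscrete (Y := r.quotient) ⟨Quotient.mk r.toSetoid, fun _ _ => rfl⟩ fun x =>
    ⟨_, r.isOpen x, r.toSetoid.refl x, fun _ hy => (Quotient.sound hy).symm⟩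

theorem proj_surjective : Function.Surjective r.proj.toMap :=
  Quotient.mk_surjective

variable {r} in
theorem proj_eq_proj {x y : X} : r.proj.toMap x = r.proj.toMap y ↔ r.toSetoid x y :=
  Quotient.eq

/-- The diagram of the quotients of a space by its open congruences. -/
def quotientFunctor (X : NomTop.{u} 𝔸) : OpenCongr X ⥤ NomSet.{u} 𝔸 where
  obj r := r.quotient
  map {r s} f :=
    { toFun := Quotient.map id fun _ _ h => leOfHom f h
      map_smul' := fun π q => by
        induction q using Quotient.inductionOn with
        | h x => rfl }
  map_id r := MulActionHom.ext fun q => by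
    induction q using Quotient.inductionOn with
    | h x => rfl
  map_comp f g := MulActionHom.ext fun q => by
    induction q using Quotient.inductionOn with
    | h x => rfl

/-- The cone of the projections onto the quotients by open congruences. -/
def cone (X : NomTop.{u} 𝔸) : Cone (quotientFunctor X ⋙ discrete 𝔸) where
  pt := X
  π := { app := fun r => r.proj }

/-- In a Stone space each point of an open set has a class of an open congruence inside that set. -/
theorem exists_class_subset (hX : X.IsStone) {U : Set X} (hU : U ∈ X.top.opens) {x : X}
    (hx : x ∈ U) : ∃ r : OpenCongr X, ∀ y, r.toSetoid x y → y ∈ U := by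
  obtain ⟨_, ⟨Y, f, A, -, -, rfl⟩, hxR, hRU⟩ :=
    exists_isBasis_representable_iff.1 hX.2.2 U hU x hx
  exact ⟨ker f, fun y (hy : f.toMap x = f.toMap y) => hRU ((congrArg (· ∈ A) hy).mp hxR)⟩

theorem eq_of_forall_proj_eq [Infinite 𝔸] (hX : X.IsStone) {x y : X}
    (h : ∀ r : OpenCongr X, r.proj.toMap x = r.proj.toMap y) : x = y := by
  classical
  by_contra hne
  set S := support x ∪ support y
  have hxS : SupportedBy 𝔸 S x := supportedBy_iff.2 Finset.subset_union_left
  have := OrbitSpace.hausdorff_iff.1 hX.2.1 S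
  have hne' : OrbitSpace.mk S x ≠ OrbitSpace.mk S y := fun h => by
    obtain ⟨π, hπ, h⟩ := OrbitSpace.mk_eq_mk.1 h
    exact hne ((hxS.smul_eq hπ).symm.trans h)
  obtain ⟨U, V, hU, -, hxU, hyV, hd⟩ := t2_separation hne'
  obtain ⟨r, hr⟩ := exists_class_subset hX (OrbitSpace.isOpen_iff.1 hU) hxU
  exact Set.disjoint_left.1 hd (hr y (proj_eq_proj.1 (h r))) hyV

/-- A bounded nominal Stone space is the limit of its quotients by open congruences. That a
compatible family of classes has a common point is the compactness of the space of `S`-orbits, for a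
common support `S` of the classes. -/
theorem isConcreteLimit_cone [Infinite 𝔸] {k : ℕ} (hb : X.toNom.Bounded k) (hX : X.IsStone) :
    IsConcreteLimit _ (cone X) := by
  constructor
  · intro z hz
    refine existsUnique_of_exists_of_unique ?_ fun x y hx hy => ?_
    · obtain ⟨i, hi⟩ := exists_support_max (k := k) (D := quotientFunctor X ⋙ discrete 𝔸)
        (fun r => bounded_of_surjective hb r.proj r.proj_surjective) hz
      set S := support (z i)
      have hcomp := OrbitSpace.compact_iff.1 hX.1 S
      obtain ⟨o, ho⟩ := IsCompact.nonempty_iInter_of_directed_nonempty_isCompact_isClosed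
        (fun r : OpenCongr X => OrbitSpace.map S r.proj ⁻¹' {OrbitSpace.mk S (z r)})
        (fun r s => by
          obtain ⟨t, htr, hts⟩ := exists_le_le r s
          have key : ∀ {r : OpenCongr X} (h : t ≤ r),
              OrbitSpace.map S t.proj ⁻¹' {OrbitSpace.mk S (z t)} ⊆
                OrbitSpace.map S r.proj ⁻¹' {OrbitSpace.mk S (z r)} := by
            intro r h o ho
            exact (OrbitSpace.map_comp t.proj (Z := (discrete 𝔸).obj r.quotient)
              ((discrete 𝔸).map ((quotientFunctor X).map (homOfLE h))) o).trans
                ((congrArg (OrbitSpace.map S _) ho).trans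
                  (congrArg (OrbitSpace.mk S) (hz (homOfLE h))))
          exact ⟨t, key htr, key hts⟩)
        (fun r => by
          obtain ⟨x, hx⟩ := r.proj_surjective (z r)
          exact ⟨OrbitSpace.mk S x, congrArg (OrbitSpace.mk S) hx⟩)
        (fun r => ((isClosed_discrete _).preimage (OrbitSpace.continuous_map _)).isCompact)
        (fun r => (isClosed_discrete _).preimage (OrbitSpace.continuous_map _))
      obtain ⟨x, rfl⟩ := OrbitSpace.mk_surjective o
      refine ⟨x, fun r => ?_⟩
      obtain ⟨π, hπ, h⟩ := OrbitSpace.mk_eq_mk.1 (Set.mem_iInter.1 ho r).symm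
      exact h.symm.trans ((supportedBy_iff.2 (hi r)).smul_eq hπ)
    · exact eq_of_forall_proj_eq hX fun r => (hx r).trans (hy r).symm
  · intro U hU x hx
    obtain ⟨r, hr⟩ := exists_class_subset hX hU hx
    exact ⟨r, {r.proj.toMap x}, (r.quotient.finitelySupported _).singleton, rfl,
      fun y hy => hr y (proj_eq_proj.1 (Eq.symm hy))⟩

end OpenCongr

/-! ### Orbit-finite discrete spaces are finitely copresentable -/

namespace IsConcreteLimit

variable {I : Type u} [Preorder I] [IsCodirectedOrder I] [Nonempty I] {𝔸 : Type} [Infinite 𝔸]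
  {D : I ⥤ NomTop.{u} 𝔸} {c : Cone D} {k : ℕ} {Y : NomSet.{u} 𝔸}

/-- A map from a codirected limit of bounded Stone spaces into a discrete space is constant on the
preimages of the classes of some open congruence on some member of the diagram. -/
theorem exists_openCongr (hc : IsConcreteLimit D c) (hb : ∀ i, (D.obj i).toNom.Bounded k)
    (hs : ∀ i, (D.obj i).IsStone) (f : c.pt ⟶ (discrete 𝔸).obj Y) :
    ∃ (i : I) (r : OpenCongr (D.obj i)), ∀ p q : c.pt,
      r.toSetoid ((c.π.app i).toMap p) ((c.π.app i).toMap q) → f.toMap q = f.toMap p := by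
  have := OrbitSpace.compact_iff.1 (hc.isStone hb hs).1 ∅
  let U : (Σ i, OpenCongr (D.obj i)) → Set c.pt := fun a => {p | ∀ q : c.pt,
    a.2.toSetoid ((c.π.app a.1).toMap p) ((c.π.app a.1).toMap q) → f.toMap q = f.toMap p}
  have hUe : ∀ a (π : FinPerm 𝔸), ∀ p ∈ U a, π • p ∈ U a := by
    intro a π p hp q hq
    have h1 := a.2.smul π⁻¹ _ _ hq
    rw [map_smul, inv_smul_smul, ← map_smul] at h1
    have h2 := hp _ h1
    rw [map_smul, inv_smul_eq_iff] at h2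
    rw [h2, map_smul]
  have hUo : ∀ a, U a ∈ c.pt.top.opens := fun a =>
    mem_opens_of_equivariant (hUe a) fun p hp =>
      ⟨_, (c.π.app a.1).continuous _ (a.2.isOpen ((c.π.app a.1).toMap p)), a.2.refl' _,
        fun q hq q' hq' => (hp q' (a.2.trans' hq hq')).trans (hp q hq).symm⟩
  have hUs : ∀ a, OrbitSpace.mk ∅ ⁻¹' (OrbitSpace.mk ∅ '' U a) = U a := fun a =>
    OrbitSpace.preimage_image_mk (supportedBy_set_of_forall fun π _ => hUe a π)
  have hne : Nonempty (Σ i, OpenCongr (D.obj i)) :=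
    ⟨⟨Classical.arbitrary I, Classical.arbitrary _⟩⟩
  have hcov : Set.univ ⊆ ⋃ a, (OrbitSpace.mk ∅ '' U a : Set (OrbitSpace c.pt ∅)) := by
    intro o _
    obtain ⟨p, rfl⟩ := OrbitSpace.mk_surjective o
    obtain ⟨i, V, hV, hpV, hVf⟩ := hc.nhds _ (preimage_singleton_mem_opens f (f.toMap p)) p rfl
    obtain ⟨r, hr⟩ := OpenCongr.exists_class_subset (hs i) hV hpV
    exact Set.mem_iUnion.2 ⟨⟨i, r⟩, p, fun q hq => hVf (hr _ hq), rfl⟩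
  have hdir : Directed (· ⊆ ·) fun a => (OrbitSpace.mk ∅ '' U a : Set (OrbitSpace c.pt ∅)) := by
    rintro ⟨i, r⟩ ⟨j, s⟩
    obtain ⟨l, hli, hlj⟩ := exists_le_le i j
    obtain ⟨t, htr, hts⟩ :=
      exists_le_le (r.comap (D.map (homOfLE hli))) (s.comap (D.map (homOfLE hlj)))
    have key : ∀ {i : I} (h : l ≤ i) (r : OpenCongr (D.obj i)),
        t ≤ r.comap (D.map (homOfLE h)) → U ⟨i, r⟩ ⊆ U ⟨l, t⟩ := by
      intro i h r htr p hp q hq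
      have h1 : r.toSetoid ((D.map (homOfLE h)).toMap ((c.π.app l).toMap p))
        ((D.map (homOfLE h)).toMap ((c.π.app l).toMap q)) := htr hq
      rw [cone_w_apply, cone_w_apply] at h1
      exact hp q h1
    exact ⟨⟨l, t⟩, Set.image_mono (key hli r htr), Set.image_mono (key hlj s hts)⟩
  obtain ⟨a, ha⟩ := isCompact_univ.elim_directed_cover _
    (fun a => OrbitSpace.isOpen_image_mk (hUo a)) hcov hdir
  refine ⟨a.1, a.2, fun p => ?_⟩
  have h1 : p ∈ OrbitSpace.mk ∅ ⁻¹' (OrbitSpace.mk ∅ '' U a) := ha (Set.mem_univ _)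
  rwa [hUs] at h1

/-- The factorization is first defined on the image of the limit in the quotient by an open
congruence `r`. As some member of the diagram maps into the classes that meet this image, it is
defined there. -/
theorem exists_factor (hc : IsConcreteLimit D c) (hb : ∀ i, (D.obj i).toNom.Bounded k)
    (hs : ∀ i, (D.obj i).IsStone) (f : c.pt ⟶ (discrete 𝔸).obj Y) :
    ∃ (i : I) (g : D.obj i ⟶ (discrete 𝔸).obj Y), c.π.app i ≫ g = f := by
  obtain ⟨i, r, hr⟩ := hc.exists_openCongr hb hs f
  obtain ⟨j, h, hW⟩ := hc.exists_hom_forall_mem hb hs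
    (W := {x | ∃ p : c.pt, r.toSetoid x ((c.π.app i).toMap p)})
    (mem_opens_of_equivariant
      (fun π x ⟨p, hp⟩ => ⟨π • p, by rw [map_smul]; exact r.smul π _ _ hp⟩)
      fun x ⟨p, hp⟩ => ⟨_, r.isOpen x, r.refl' x, fun y hy => ⟨p, r.trans' (r.symm' hy) hp⟩⟩)
    (fun π x ⟨p, hp⟩ => ⟨π • p, by rw [map_smul]; exact r.smul π _ _ hp⟩)
    fun p => ⟨p, r.refl' _⟩
  choose φ hφ using hW
  have hφ' : ∀ x (p : c.pt), r.toSetoid ((D.map h).toMap x) ((c.π.app i).toMap p) →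
      f.toMap (φ x) = f.toMap p := fun x p hp => hr _ _ (r.trans' (r.symm' hp) (hφ x))
  refine ⟨j, homDiscrete ⟨fun x => f.toMap (φ x), fun π x => ?_⟩ fun x => ?_, ?_⟩
  · refine (hφ' _ (π • φ x) ?_).trans (map_smul _ _ _)
    rw [map_smul, map_smul]
    exact r.smul π _ _ (hφ x)
  · exact ⟨_, (r.comap (D.map h)).isOpen x, r.refl' _, fun y hy =>
      hφ' y (φ x) (r.trans' (r.symm' hy) (hφ x))⟩
  · refine NomTop.Hom.ext (MulActionHom.ext fun p => hφ' _ p ?_)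
    rw [cone_w_apply c h]

theorem exists_hom_comp_eq (hc : IsConcreteLimit D c) (hb : ∀ i, (D.obj i).toNom.Bounded k)
    (hs : ∀ i, (D.obj i).IsStone) {i : I} {g g' : D.obj i ⟶ (discrete 𝔸).obj Y}
    (h : c.π.app i ≫ g = c.π.app i ≫ g') :
    ∃ (j : I) (f : j ⟶ i), D.map f ≫ g = D.map f ≫ g' := by
  have hWe : ∀ (π : FinPerm 𝔸) (x : D.obj i), g.toMap x = g'.toMap x →
      g.toMap (π • x) = g'.toMap (π • x) := fun π x hx => by
    rw [map_smul, map_smul, hx]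
  obtain ⟨j, f, hf⟩ := hc.exists_hom_forall_mem hb hs (W := {x | g.toMap x = g'.toMap x})
    (mem_opens_of_equivariant hWe fun x hx => ⟨_, (D.obj i).top.inter_mem _
      (preimage_singleton_mem_opens g (g.toMap x)) _
      (preimage_singleton_mem_opens g' (g'.toMap x)), ⟨rfl, rfl⟩,
      fun y hy => hy.1.trans (Eq.trans hx hy.2.symm)⟩)
    hWe fun p => congrArg (fun f : c.pt ⟶ (discrete 𝔸).obj Y => f.toMap p) h
  exact ⟨j, f, NomTop.Hom.ext (MulActionHom.ext hf)⟩

end IsConcreteLimit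

/-! ### A criterion for Pro-completions -/

section Criterion

variable {C : Type*} [Category C] {P : Type*} [Category P] {E : C ⥤ P}
  {H : Type*} [Category H] {F : C ⥤ H}

/-- An object `Y` is finitely copresentable, relative to the small codirected limits: each map from
such a limit to `Y` factors through a member of the diagram, and essentially uniquely. -/
def FinitelyCopresentable (Y : P) : Prop :=
  ∀ (I : Type u) [Preorder I] [Nonempty I] [IsCodirectedOrder I] (K : I ⥤ P) (c : Cone K),
    IsLimit c → (∀ f : c.pt ⟶ Y, ∃ (i : I) (g : K.obj i ⟶ Y), c.π.app i ≫ g = f) ∧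
      ∀ (i : I) (g g' : K.obj i ⟶ Y), c.π.app i ≫ g = c.π.app i ≫ g' →
        ∃ (j : I) (h : j ⟶ i), K.map h ≫ g = K.map h ≫ g'

/-- The object `X` is the limit of a small codirected diagram that factors through `E : C ⥤ P`. -/
def IsCodirectedLimitOf (E : C ⥤ P) (X : P) : Prop :=
  ∃ (I : Type u) (_ : Preorder I) (_ : Nonempty I) (_ : IsCodirectedOrder I)
    (D : I ⥤ C) (c : Cone (D ⋙ E)), c.pt = X ∧ Nonempty (IsLimit c)

/-- A presentation of `X` as a codirected limit is initial in the category of arrows from `X` to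
`E`, which makes the limit defining the pointwise right Kan extension at `X` a codirected one. -/
theorem hasPointwiseRightKanExtensionAt_of_copresentable [E.Full] [E.Faithful]
    (hcop : ∀ Y, FinitelyCopresentable.{u} (E.obj Y)) (hH : HasCodirectedLimits.{u} H) {X : P}
    (hX : IsCodirectedLimitOf.{u} E X) : E.HasPointwiseRightKanExtensionAt F X := by
  obtain ⟨I, _, _, _, D, c, rfl, ⟨hc⟩⟩ := hX
  let Φ : I ⥤ StructuredArrow c.pt E :=
    D.toStructuredArrow c.pt E (fun i => c.π.app i) fun f => c.w f
  have : Φ.Initial := by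
    refine Functor.initial_of_exists_of_isCofiltered Φ (fun d => ?_) fun {d i} s s' => ?_
    · obtain ⟨i, g, hg⟩ := (hcop d.right I _ c hc).1 d.hom
      exact ⟨i, ⟨StructuredArrow.homMk (E.preimage g) 
        ((congrArg (c.π.app i ≫ ·) (E.map_preimage g)).trans hg)⟩⟩
    · obtain ⟨j, h, hh⟩ := (hcop d.right I _ c hc).2 i (E.map s.right) (E.map s'.right)
        ((StructuredArrow.w s).trans (StructuredArrow.w s').symm)
      refine ⟨j, h, StructuredArrow.ext _ _ (E.map_injective ?_)⟩
      exact (E.map_comp (D.map h) s.right).trans (hh.trans (E.map_comp (D.map h) s'.right).symm)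
  have := hH I
  exact Functor.Initial.hasLimit_of_comp Φ

/-- A pointwise right Kan extension `G` along a functor `E` with finitely copresentable values
preserves codirected limits: a cone over the values of the diagram determines, for each map from the
limit to a copresentable object, a component through any factorization of that map. The Kan
extension is given by its counit `ε` and the universal property of its values. -/
theorem preservesCodirectedLimits_of_copresentable
    (hcop : ∀ Y, FinitelyCopresentable.{u} (E.obj Y)) {G : P ⥤ H}
    (ε : ∀ Y, G.obj (E.obj Y) ⟶ F.obj Y)
    (hε : ∀ {Y Z : C} (φ : Y ⟶ Z), G.map (E.map φ) ≫ ε Z = ε Y ≫ F.map φ)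
    (hext : ∀ {X : P} {T : H} {a b : T ⟶ G.obj X},
      (∀ (Y : C) (φ : X ⟶ E.obj Y), a ≫ G.map φ ≫ ε Y = b ≫ G.map φ ≫ ε Y) → a = b)
    (hlift : ∀ (X : P) (T : H) (t : ∀ Y, (X ⟶ E.obj Y) → (T ⟶ F.obj Y)),
      (∀ {Y Z : C} (φ : X ⟶ E.obj Y) (ψ : Y ⟶ Z), t Z (φ ≫ E.map ψ) = t Y φ ≫ F.map ψ) →
        ∃ a : T ⟶ G.obj X, ∀ Y φ, a ≫ G.map φ ≫ ε Y = t Y φ) :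
    PreservesCodirectedLimits.{u} G := by
  intro I _ _ _
  refine ⟨fun {K} => ⟨fun {c} hc => ?_⟩⟩
  have hfac := fun Y => (hcop Y I K c hc).1
  have huniq := fun Y => (hcop Y I K c hc).2
  have hw : ∀ (s : Cone (K ⋙ G)) {i j : I} (f : i ⟶ j), s.π.app i ≫ G.map (K.map f) = s.π.app j :=
    fun s _ _ f => s.w f
  -- The component of a cone does not depend on the factorization.
  have hindep : ∀ (s : Cone (K ⋙ G)) (Y : C) (i j : I) (g : K.obj i ⟶ E.obj Y)
      (g' : K.obj j ⟶ E.obj Y), c.π.app i ≫ g = c.π.app j ≫ g' →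
      s.π.app i ≫ G.map g ≫ ε Y = s.π.app j ≫ G.map g' ≫ ε Y := by
    intro s Y i j g g' h
    obtain ⟨l, hli, hlj⟩ := exists_le_le i j
    obtain ⟨m, f, hf⟩ := huniq Y l (K.map (homOfLE hli) ≫ g) (K.map (homOfLE hlj) ≫ g') (by
      rw [← Category.assoc, ← Category.assoc, c.w, c.w, h])
    rw [← Category.assoc, ← Category.assoc, ← K.map_comp, ← K.map_comp] at hf
    rw [← hw s (f ≫ homOfLE hli), ← hw s (f ≫ homOfLE hlj), Category.assoc, Category.assoc,
      ← G.map_comp_assoc, ← G.map_comp_assoc, hf]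
  choose i g hg using hfac
  have key : ∀ s : Cone (K ⋙ G), ∃ a : s.pt ⟶ G.obj c.pt,
      ∀ Y φ, a ≫ G.map φ ≫ ε Y = s.π.app (i Y φ) ≫ G.map (g Y φ) ≫ ε Y := fun s =>
    hlift c.pt s.pt (fun Y φ => s.π.app (i Y φ) ≫ G.map (g Y φ) ≫ ε Y) fun {Y Z} φ ψ => by
      rw [Category.assoc, Category.assoc, ← hε, ← G.map_comp_assoc]
      refine hindep s _ _ _ _ _ ?_
      rw [hg, ← Category.assoc, hg]
  choose a ha using key
  have hfacs : ∀ (s : Cone (K ⋙ G)) (j : I), a s ≫ G.map (c.π.app j) = s.π.app j := by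
    refine fun s j => hext fun Y φ => ?_
    rw [Category.assoc, ← G.map_comp_assoc, ha]
    exact hindep s _ _ _ _ _ (hg _ _)
  refine ⟨⟨a, hfacs, fun s m hm => hext fun Y φ => ?_⟩⟩
  have hm' : m ≫ G.map (c.π.app (i Y φ)) = s.π.app (i Y φ) := hm _
  rw [ha, ← hm', Category.assoc, ← G.map_comp_assoc, hg]

/-- A natural transformation between functors preserving codirected limits is invertible if its
whiskering with `E` is, provided that all objects are codirected limits of objects in the image
of `E`. -/
theorem isIso_of_isIso_whiskerLeft (happ : ∀ X : P, IsCodirectedLimitOf.{u} E X) {G G' : P ⥤ H}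
    (hG : PreservesCodirectedLimits.{u} G) (hG' : PreservesCodirectedLimits.{u} G') (β : G ⟶ G')
    [IsIso (Functor.whiskerLeft E β)] : IsIso β := by
  refine (NatTrans.isIso_iff_isIso_app β).2 fun X => ?_
  obtain ⟨I, _, _, _, D, c, rfl, ⟨hc⟩⟩ := happ X
  have := hG I
  have := hG' I
  let e : (D ⋙ E) ⋙ G ≅ (D ⋙ E) ⋙ G' :=
    asIso (Functor.whiskerLeft D (Functor.whiskerLeft E β))
  have h1 : β.app c.pt = ((isLimitOfPreserves G hc).conePointsIsoOfNatIso
      (isLimitOfPreserves G' hc) e).hom := by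
    refine (isLimitOfPreserves G' hc).hom_ext fun i => ?_
    rw [IsLimit.conePointsIsoOfNatIso_hom_comp]
    simp [e]
  rw [h1]
  infer_instance

open Classical in
/-- If `E` is injective on objects, a functor `G` with `E ⋙ G ≅ F` is isomorphic to a functor that
strictly extends `F`. -/
theorem exists_strict_extension (hinj : Function.Injective E.obj) (G : P ⥤ H) (e : E ⋙ G ≅ F) :
    ∃ (F' : P ⥤ H) (θ : F' ≅ G) (h : E ⋙ F' = F),
      Functor.whiskerLeft E θ.hom ≫ e.hom = eqToHom h := by
  let obj : P → H := fun X => if h : ∃ Y, E.obj Y = X then F.obj h.choose else G.obj X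
  have hobj : ∀ Y, obj (E.obj Y) = F.obj Y := fun Y => by
    have h : ∃ Z, E.obj Z = E.obj Y := ⟨Y, rfl⟩
    simp only [obj, dif_pos h]
    exact congrArg F.obj (hinj h.choose_spec)
  have hiso : ∀ X, ∃ i : G.obj X ≅ obj X, ∀ (Y : C) (h : E.obj Y = X),
      i.hom = G.map (eqToHom h.symm) ≫ e.hom.app Y ≫ eqToHom (by rw [← h, hobj]) := by
    intro X
    by_cases h : ∃ Y, E.obj Y = X
    · obtain ⟨Y, rfl⟩ := h
      refine ⟨e.app Y ≪≫ eqToIso (hobj Y).symm, fun Z hZ => ?_⟩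
      obtain rfl := hinj hZ
      simp
    · exact ⟨eqToIso (by simp only [obj, dif_neg h]), fun Y hY => absurd ⟨Y, hY⟩ h⟩
  choose i hi using hiso
  have hi' : ∀ Y, (i (E.obj Y)).hom = e.hom.app Y ≫ eqToHom (hobj Y).symm := fun Y => by
    simpa using hi _ Y rfl
  have hi'' : ∀ Y, (i (E.obj Y)).inv = eqToHom (hobj Y) ≫ e.inv.app Y := fun Y => by
    rw [← cancel_epi (i (E.obj Y)).hom, Iso.hom_inv_id, hi']
    simp
  have hext : E ⋙ G.copyObj obj i = F := by
    refine CategoryTheory.Functor.ext hobj fun Y Z f => ?_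
    change (i _).inv ≫ G.map (E.map f) ≫ (i _).hom = _
    rw [hi', hi'']
    have := e.hom.naturality f
    dsimp at this
    rw [reassoc_of% this]
    simp
    rfl
  refine ⟨G.copyObj obj i, (G.isoCopyObj obj i).symm, hext, ?_⟩
  ext Y
  rw [eqToHom_app]
  change (i (E.obj Y)).inv ≫ e.hom.app Y = _
  rw [hi'']
  simp
  rfl

/-- A full embedding with finitely copresentable values whose codirected limits exhaust the target
is a Pro-completion: the extension of a functor is its pointwise right Kan extension. -/
theorem isProCompletion_of_copresentable [E.Full] [E.Faithful]
    (hinj : Function.Injective E.obj) (hP : HasCodirectedLimits.{u} P)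
    (hcop : ∀ Y, FinitelyCopresentable.{u} (E.obj Y))
    (happ : ∀ X : P, IsCodirectedLimitOf.{u} E X) : IsProCompletion.{u, v', u'} E where
  hasCodirectedLimits := hP
  full := inferInstance
  faithful := inferInstance
  injective := hinj
  extension := by
    intro H _ hH F
    have : E.HasPointwiseRightKanExtension F := fun X =>
      hasPointwiseRightKanExtensionAt_of_copresentable hcop hH (happ X)
    let R : Functor.RightExtension E F :=
      Functor.RightExtension.mk _ (E.pointwiseRightKanExtensionCounit F)
    have hR : R.IsPointwiseRightKanExtension :=
      E.pointwiseRightKanExtensionIsPointwiseRightKanExtension F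
    have hRpres : PreservesCodirectedLimits.{u} R.left :=
      preservesCodirectedLimits_of_copresentable hcop (fun Y => R.hom.app Y)
        (fun φ => R.hom.naturality φ) (fun {X T a b} h => (hR X).hom_ext' h) fun X T t ht =>
          ⟨(hR X).lift ⟨T, { app := fun d => t d.right d.hom
                             naturality := fun d d' φ => by
                              refine (Category.id_comp _).trans ?_
                              rw [← StructuredArrow.w φ]
                              exact ht d.hom φ.right }⟩,
            fun Y φ => (hR X).fac _ (StructuredArrow.mk φ)⟩
    have hRiso : IsIso R.hom := hR.isIso_hom
    let e : E ⋙ R.left ≅ F := asIso R.hom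
    obtain ⟨F', θ, hF', hθ⟩ := exists_strict_extension hinj R.left e
    refine ⟨F', fun I _ _ _ => ?_, hF', fun G hG hGF => ?_⟩
    · have := hRpres I
      exact preservesLimitsOfShape_of_natIso θ.symm
    · let β : G ⟶ R.left := (hR.homTo (Functor.RightExtension.mk G (eqToHom hGF))).left
      have hβ : Functor.whiskerLeft E β ≫ e.hom = eqToHom hGF :=
        CostructuredArrow.w (hR.homTo (Functor.RightExtension.mk G (eqToHom hGF)))
      have : IsIso (Functor.whiskerLeft E β) := by
        rw [← Iso.eq_comp_inv] at hβ
        rw [hβ]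
        infer_instance
      have : IsIso β := isIso_of_isIso_whiskerLeft happ hG hRpres β
      refine ⟨θ ≪≫ (asIso β).symm, ?_⟩
      have h1 : Functor.whiskerLeft E (θ ≪≫ (asIso β).symm).hom ≫ Functor.whiskerLeft E β =
          Functor.whiskerLeft E θ.hom := by
        rw [← Functor.whiskerLeft_comp]
        simp
      rw [← cancel_mono (Functor.whiskerLeft E β), h1, ← cancel_mono e.hom, hθ, Category.assoc, hβ,
        eqToHom_trans]

end Criterion

/-! ### The category of bounded nominal Stone spaces -/

section NStone

variable {𝔸 : Type} {k : ℕ}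

instance : (discreteStone.{u} 𝔸 k).Full where
  map_surjective f := ⟨ObjectProperty.homMk f.hom.toMap, rfl⟩

instance : (discreteStone.{u} 𝔸 k).Faithful where
  map_injective h := ObjectProperty.hom_ext _ (congrArg (fun f => f.hom.toMap) h)

theorem discreteStone_obj_injective : Function.Injective (discreteStone.{u} 𝔸 k).obj :=
  fun _ _ h => ObjectProperty.FullSubcategory.ext
    (congrArg (fun X : NStone.{u} 𝔸 k => X.obj.toNom) h)

section

variable {I : Type u} [Preorder I] {K : I ⥤ NStone.{u} 𝔸 k}

theorem nonempty_isLimit_of_isConcreteLimit {c : Cone K}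
    (hc : IsConcreteLimit (K ⋙ (isBoundedStone 𝔸 k).ι) ((isBoundedStone 𝔸 k).ι.mapCone c)) :
    Nonempty (IsLimit c) :=
  hc.nonempty_isLimit.map fun h => isLimitOfReflects _ h

variable [Infinite 𝔸] [Nonempty I] [IsCodirectedOrder I]

theorem exists_cone_isConcreteLimit (K : I ⥤ NStone.{u} 𝔸 k) : ∃ c : Cone K,
    IsConcreteLimit (K ⋙ (isBoundedStone 𝔸 k).ι) ((isBoundedStone 𝔸 k).ι.mapCone c) := by
  have hb : ∀ i, ((K ⋙ (isBoundedStone 𝔸 k).ι).obj i).toNom.Bounded k :=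
    fun i => (K.obj i).property.1
  obtain ⟨c, hc⟩ := exists_isConcreteLimit (K ⋙ (isBoundedStone 𝔸 k).ι) hb
  exact ⟨⟨⟨c.pt, hc.bounded hb, hc.isStone hb fun i => (K.obj i).property.2⟩,
    { app := fun i => ObjectProperty.homMk (c.π.app i)
      naturality := fun i j f => ObjectProperty.hom_ext _ (c.π.naturality f) }⟩, hc⟩

theorem isConcreteLimit_of_isLimit {c : Cone K} (hc : IsLimit c) :
    IsConcreteLimit (K ⋙ (isBoundedStone 𝔸 k).ι) ((isBoundedStone 𝔸 k).ι.mapCone c) := by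
  obtain ⟨c', hc'⟩ := exists_cone_isConcreteLimit K
  obtain ⟨hl⟩ := nonempty_isLimit_of_isConcreteLimit hc'
  exact hc'.of_iso ((Cone.functoriality K _).mapIso (hl.uniqueUpToIso hc))

end

variable [Infinite 𝔸]

theorem hasCodirectedLimits_nStone : HasCodirectedLimits.{u} (NStone.{u} 𝔸 k) :=
  fun I _ _ _ => ⟨fun K => by
    obtain ⟨c, hc⟩ := exists_cone_isConcreteLimit K
    obtain ⟨hl⟩ := nonempty_isLimit_of_isConcreteLimit hc
    exact ⟨⟨⟨c, hl⟩⟩⟩⟩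

theorem finitelyCopresentable_discreteStone (Y : NomOF.{u} 𝔸 k) :
    FinitelyCopresentable.{u} ((discreteStone 𝔸 k).obj Y) := by
  intro I _ _ _ K c hc
  have hl := isConcreteLimit_of_isLimit hc
  have hb : ∀ i, ((K ⋙ (isBoundedStone 𝔸 k).ι).obj i).toNom.Bounded k :=
    fun i => (K.obj i).property.1
  have hs : ∀ i, ((K ⋙ (isBoundedStone 𝔸 k).ι).obj i).IsStone :=
    fun i => (K.obj i).property.2
  refine ⟨fun f => ?_, fun i g g' h => ?_⟩
  · obtain ⟨i, g, hg⟩ := hl.exists_factor (Y := Y.obj) hb hs f.hom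
    exact ⟨i, ObjectProperty.homMk g, ObjectProperty.hom_ext _ hg⟩
  · obtain ⟨j, f, hf⟩ := hl.exists_hom_comp_eq (Y := Y.obj) hb hs (g := g.hom) (g' := g'.hom)
      (congrArg (fun f => f.hom) h)
    exact ⟨j, f, ObjectProperty.hom_ext _ hf⟩

/-- The diagram of the discrete quotients of a bounded nominal Stone space. -/
def OpenCongr.stoneDiagram (X : NStone.{u} 𝔸 k) : OpenCongr X.obj ⥤ NomOF.{u} 𝔸 k :=
  (isBoundedOrbitFinite 𝔸 k).lift (quotientFunctor X.obj) fun r =>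
    ⟨bounded_of_surjective X.property.1 r.proj r.proj_surjective,
      orbitFinite_of_surjective X.property.2.1 r.proj r.proj_surjective⟩

/-- A bounded nominal Stone space as a cone over its discrete quotients. -/
def OpenCongr.stoneCone (X : NStone.{u} 𝔸 k) : Cone (stoneDiagram X ⋙ discreteStone 𝔸 k) where
  pt := X
  π :=
    { app := fun r => ObjectProperty.homMk r.proj
      naturality := fun _ _ f => ObjectProperty.hom_ext _ ((cone X.obj).π.naturality f) }

theorem isCodirectedLimitOf_discreteStone (X : NStone.{u} 𝔸 k) :
    IsCodirectedLimitOf.{u} (discreteStone.{u} 𝔸 k) X :=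
  ⟨_, _, inferInstance, inferInstance, _, OpenCongr.stoneCone X, rfl,
    nonempty_isLimit_of_isConcreteLimit
      (OpenCongr.isConcreteLimit_cone X.property.1 X.property.2)⟩

theorem isCodirectedLimitOfDiscrete_iff {X : NomTop.{u} 𝔸} :
    (X.toNom.Bounded k ∧ X.IsStone) ↔ IsCodirectedLimitOfDiscrete.{u} k X := by
  constructor
  · intro hX
    exact ⟨OpenCongr X, _, inferInstance, inferInstance, OpenCongr.stoneDiagram ⟨X, hX⟩,
      OpenCongr.cone X, rfl, (OpenCongr.isConcreteLimit_cone hX.1 hX.2).nonempty_isLimit⟩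
  · rintro ⟨I, _, _, _, D, c, rfl, ⟨hc⟩⟩
    have hb : ∀ i, ((D ⋙ (isBoundedOrbitFinite 𝔸 k).ι ⋙ discrete 𝔸).obj i).toNom.Bounded k :=
      fun i => (D.obj i).property.1
    have hl := IsConcreteLimit.of_isLimit hc hb
    exact ⟨hl.bounded hb, hl.isStone hb fun i => isStone_discrete _ (D.obj i).property.2⟩

end NStone

end NominalStone

theorem mainTheorem1 (𝔸 : Type) [Countable 𝔸] [Infinite 𝔸] (k : ℕ) :
    NominalStone.IsProCompletion.{u, v', u'} (NominalStone.discreteStone.{u} 𝔸 k) ∧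
      ∀ X : NominalStone.NomTop.{u} 𝔸,
        (X.toNom.Bounded k ∧ X.IsStone) ↔ NominalStone.IsCodirectedLimitOfDiscrete.{u} k X :=
  ⟨NominalStone.isProCompletion_of_copresentable NominalStone.discreteStone_obj_injective
    NominalStone.hasCodirectedLimits_nStone NominalStone.finitelyCopresentable_discreteStone
    NominalStone.isCodirectedLimitOf_discreteStone,
    fun _ => NominalStone.isCodirectedLimitOfDiscrete_iff⟩
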